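/- **Setting.** Let $k\in\mathbb N$, let $\Omega$ be a locally compact Hausdorff space and let $T_1,\dots,T_k:\Omega\to\Omega$ be pairwise commuting local homeomorphisms (a topological dynamical system; surjectivity is not assumed). For $m\in\mathbb N^k$ put $\Theta_m=T_1^{m_1}\cdots T_k^{m_k}$. Let $\Lambda$ be the associated topological $k$-graph: objects $\Omega$, morphisms $\mathbb N^k\times\Omega$, $r(m,x)=x$, $s(m,x)=\Theta_m(x)$, $(m,x)(n,\Theta_m(x))=(m+n,x)$, $d(m,x)=m$. Let $A=C_0(\Omega)$, and let $X=X^\Lambda$ be the topological $k$-graph correspondence: the product system over $\mathbb N^k$ of $A$-correspondences whose fibre $X_m$ is the completion of $C_c(\{m\}\times\Omega)$ for $$\langle\xi,\eta\rangle_m(x)=\sum_{\Theta_m(y)=x}\overline{\xi(m,y)}\,\eta(m,y),\qquad (f\cdot\xi\cdot g)(m,x)=f(x)\,\xi(m,x)\,g(\Theta_m(x)),$$ with multiplication $X_m\times X_n\to X_{m+n}$, $(\xi\eta)(m+n,x)=\xi(m,x)\,\eta(n,\Theta_m(x))$, and with $X_0$ identified with $A$. **Notation.** Write $\phi_m:A\to\mathcal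 L(X_m)$ for the left action and $\mathcal K(X_m)$ for the closed linear span of the operators $\Theta_{\xi,\eta}:\zeta\mapsto\xi\cdot\langle\eta,\zeta\rangle_m$. For $0\ne p\le q$ let $\iota_p^q:\mathcal L(X_p)\to\mathcal L(X_q)$ be given by $\iota_p^q(T)(\xi\eta)=T(\xi)\eta$ for $\xi\in X_p$, $\eta\in X_{q-p}$; let $\iota_0^q=\phi_q$ on $\mathcal K(X_0)\cong A$; and put $\iota_p^q=0$ if $p\not\le q$. $X$ is *compactly aligned* if $\iota_p^{p\vee q}(S)\,\iota_q^{p\vee q}(T)\in\mathcal K(X_{p\vee q})$ for all $p,q$ and all $S\in\mathcal K(X_p)$, $T\in\mathcal K(X_q)$. Let $I_0=A$, $I_p=\bigcap_{0<r\le p}\ker\phi_r$ for $p\neq0$, and $\widetilde X_q=\bigoplus_{p\le q}X_p\cdot I_{q-p}$, with $(\widetilde\phi_q(a)\xi)(p)=\phi_p(a)\xi(p)$ and $(\widetilde\iota_p^{\,q}(S)\xi)(r)=\iota_p^r(S)\xi(r)$. **Representations.** A representation $\psi$ of $X$ in a $C^*$-algebra $B$ consists of linear maps $\psi_m:X_m\to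 B$ such that $\psi_0$, regarded as a map on $A$, is a $*$-homomorphism, $\psi_m(a\cdot\xi\cdot b)=\psi_0(a)\psi_m(\xi)\psi_0(b)$, $\psi_m(\xi)^*\psi_m(\eta)=\psi_0(\langle\xi,\eta\rangle_m)$ and $\psi_{m+n}(\xi\eta)=\psi_m(\xi)\psi_n(\eta)$. Let $\psi^{(m)}:\mathcal K(X_m)\to B$ be the homomorphism with $\psi^{(m)}(\Theta_{\xi,\eta})=\psi_m(\xi)\psi_m(\eta)^*$. * $\psi$ satisfies (CP-K) if $\psi^{(m)}(\phi_m(a))=\psi_0(a)$ for all $m$ and all $a\in\phi_m^{-1}(\mathcal K(X_m))\cap(\ker\phi_m)^\perp$. The Cuntz–Pimsner algebra $\mathcal O_X$ is the universal $C^*$-algebra generated by a representation $j^{Fow}$ of $X$ satisfying (CP-K). * If $X$ is compactly aligned and every $\widetilde\phi_q$ is injective, $\psi$ is CNP-covariant if (N) $\psi^{(p)}(S)\psi^{(q)}(T)=\psi^{(p\vee q)}\big(\iota_p^{p\vee q}(S)\iota_q^{p\vee q}(T)\big)$ for all $p,q\in\mathbb N^k$, $S\in\mathcal K(X_p)$,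 $T\in\mathcal K(X_q)$; and (CP-SY) $\sum_{p\in F}\psi^{(p)}(T_p)=0$ for every finite $F\subset\mathbb N^k$ and every choice of $T_p\in\mathcal K(X_p)$, $p\in F$, such that $\sum_{p\in F}\widetilde\iota_p^{\,s}(T_p)=0$ for large $s$, that is, such that for every $q\in\mathbb N^k$ there is $r\ge q$ with $\sum_{p\in F}\widetilde\iota_p^{\,s}(T_p)=0$ for all $s\ge r$. The Cuntz–Nica–Pimsner algebra $\mathcal{NO}_X$ is the universal $C^*$-algebra generated by a CNP-covariant representation $j^{CNP}$ of $X$. **Corollary.** The product system $X^\Lambda$ is compactly aligned and each $\widetilde\phi_q$ is injective, so that $\mathcal{NO}_{X^\Lambda}$ is defined, and $$\mathcal{NO}_{X^\Lambda}\cong\mathcal O_{X^\Lambda}$$ by a $*$-isomorphism that carries $j^{CNP}_m(\xi)$ to $j^{Fow}_m(\xi)$ for all $m\in\mathbb N^k$ and $\xi\in X^\Lambda_m$. -/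

import Mathlib

open scoped ENNReal ZeroAtInfty

noncomputable section

/-- A `C*`-correspondence over the `C*`-algebra `A` (an `A`-correspondence) on the complete normed
space `E`: a right Hilbert `A`-module with `A`-valued inner product `inner`, linear in the second
variable, right action `right`, whose norm is the given norm, together with a homomorphism `left`
(written `φ` in the docstrings) of `A` into the adjointable operators on `E`.  The remaining laws of
a right module follow from the listed ones because the inner product is definite. -/
class Correspondence (A E : Type*) [NonUnitalCStarAlgebra A] [NormedAddCommGroup E]
    [NormedSpace ℂ E] [CompleteSpace E] where
  inner : E → E → A
  right : E → A → E
  left : A →ₙₐ[ℂ] (E →L[ℂ] E)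
  inner_add_right : ∀ x y z, inner x (y + z) = inner x y + inner x z
  inner_smul_right : ∀ (c : ℂ) x y, inner x (c • y) = c • inner x y
  inner_right : ∀ x y a, inner x (right y a) = inner x y * a
  star_inner : ∀ x y, star (inner x y) = inner y x
  inner_self_nonneg : ∀ x, ∃ b, inner x x = star b * b
  norm_sq : ∀ x, ‖x‖ ^ 2 = ‖inner x x‖
  inner_left : ∀ a x y, inner (left a x) y = inner x (left (star a) y)

namespace Correspondence

variable {A E : Type*} [NonUnitalCStarAlgebra A] [NormedAddCommGroup E]
    [NormedSpace ℂ E] [CompleteSpace E] [Correspondence A E]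

theorem inner_add_left (x y z : E) : inner (A := A) (x + y) z = inner x z + inner y z := by
  rw [← star_inner, inner_add_right, star_add, star_inner, star_inner]

theorem inner_smul_left (c : ℂ) (x y : E) : inner (A := A) (c • x) y = star c • inner x y := by
  rw [← star_inner, inner_smul_right, star_smul, star_inner]

theorem inner_right_left (x y : E) (a : A) : inner (right x a) y = star a * inner x y := by
  rw [← star_inner, inner_right, star_mul, star_inner]

theorem norm_right_le (x : E) (a : A) : ‖right x a‖ ≤ ‖x‖ * ‖a‖ := by
  refine le_of_sq_le_sq ?_ (by positivity)
  rw [norm_sq (A := A), inner_right, inner_right_left, mul_pow, norm_sq (A := A)]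
  calc _ ≤ ‖star a‖ * ‖inner (A := A) x x‖ * ‖a‖ :=
        (norm_mul_le _ _).trans (by gcongr; exact norm_mul_le _ _)
    _ = _ := by rw [norm_star]; ring

/-- The Cauchy-Schwarz inequality, obtained by viewing `E` as a Hilbert module in Mathlib's
convention over the opposite algebra. -/
theorem norm_inner_le (x y : E) : ‖inner (A := A) x y‖ ≤ ‖x‖ * ‖y‖ := by
  let _ : PartialOrder Aᵐᵒᵖ := CStarAlgebra.spectralOrder _
  have : StarOrderedRing Aᵐᵒᵖ := CStarAlgebra.spectralOrderedRing _
  let _ : SMul Aᵐᵒᵖ E := ⟨fun a x => right x a.unop⟩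
  let _ : CStarModule Aᵐᵒᵖ E :=
    { inner := fun x y => MulOpposite.op (inner x y)
      inner_add_right := by intro x y z; simp [inner_add_right]
      inner_self_nonneg := by
        intro x
        obtain ⟨b, hb⟩ := inner_self_nonneg (A := A) x
        simp only [hb]
        exact mul_star_self_nonneg (MulOpposite.op b)
      inner_self := by
        intro x
        simp only [MulOpposite.op_eq_zero_iff]
        rw [← norm_eq_zero, ← norm_sq]; simp
      inner_op_smul_right := by
        intro a x y
        change MulOpposite.op (inner x (right y a.unop)) = _
        rw [inner_right]; simp
      inner_smul_right_complex := by intro z x y; simp [inner_smul_right]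
      star_inner := by intro x y; rw [← MulOpposite.op_star, star_inner]
      norm_eq_sqrt_norm_inner_self := by
        intro x
        rw [MulOpposite.norm_op, ← norm_sq, Real.sqrt_sq (norm_nonneg _)] }
  exact CStarModule.norm_inner_le (A := Aᵐᵒᵖ) E (x := x) (y := y)

theorem ext_inner {x y : E} (h : ∀ z, inner (A := A) z x = inner z y) : x = y := by
  have h0 : inner (A := A) (x - y) (x - y) = 0 := by
    have e : x - y = x + (-1 : ℂ) • y := by simp [sub_eq_add_neg]
    have (z : E) : inner (A := A) z (x - y) = 0 := by
      rw [e, inner_add_right, inner_smul_right, h]; simp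
    exact this _
  have h1 : ‖x - y‖ ^ 2 = 0 := by rw [norm_sq (A := A), h0, norm_zero]
  rwa [sq_eq_zero_iff, norm_eq_zero, sub_eq_zero] at h1

theorem right_add (x : E) (a b : A) : right x (a + b) = right x a + right x b :=
  ext_inner (A := A) fun z => by simp only [inner_add_right, inner_right, mul_add]

theorem right_smul (x : E) (c : ℂ) (a : A) : right x (c • a) = c • right x a :=
  ext_inner (A := A) fun z => by simp only [inner_smul_right, inner_right, mul_smul_comm]

/-- The rank-one operator `Θ_{ξ,η} ζ = ξ · ⟨η, ζ⟩`. -/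
def theta (A : Type*) {E : Type*} [NonUnitalCStarAlgebra A] [NormedAddCommGroup E]
    [NormedSpace ℂ E] [CompleteSpace E] [Correspondence A E] (ξ η : E) : E →L[ℂ] E :=
  LinearMap.mkContinuous
    { toFun := fun ζ => right ξ (inner (A := A) η ζ)
      map_add' := fun ζ ζ' => by rw [inner_add_right, right_add]
      map_smul' := fun c ζ => by rw [inner_smul_right, right_smul]; rfl }
    (‖ξ‖ * ‖η‖) fun ζ => by
      refine (norm_right_le _ _).trans ?_
      rw [mul_assoc]
      gcongr
      exact norm_inner_le _ _

/-- The generalized compact operators `K(E)`: the closed linear span, in the operator norm, of the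
rank-one operators. -/
def compacts (A E : Type*) [NonUnitalCStarAlgebra A] [NormedAddCommGroup E]
    [NormedSpace ℂ E] [CompleteSpace E] [Correspondence A E] : Submodule ℂ (E →L[ℂ] E) :=
  (Submodule.span ℂ (Set.range fun p : E × E => theta A p.1 p.2)).topologicalClosure

/-- `T` is adjointable with adjoint `S`. -/
def IsAdjointPair (A : Type*) {E : Type*} [NonUnitalCStarAlgebra A] [NormedAddCommGroup E]
    [NormedSpace ℂ E] [CompleteSpace E] [Correspondence A E] (T S : E →L[ℂ] E) : Prop :=
  ∀ x y, inner (A := A) (T x) y = inner x (S y)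

end Correspondence

theorem le_of_pow_two_pow_le {a b C : ℝ} (hb : 0 ≤ b)
    (h : ∀ j : ℕ, a ^ 2 ^ j ≤ C * b ^ (2 ^ j - 1)) : a ≤ b := by
  rcases hb.eq_or_lt with rfl | hb
  · have := h 1
    simp at this
    nlinarith [sq_nonneg a]
  by_contra! hab
  have hr : 1 < a / b := (one_lt_div hb).2 hab
  obtain ⟨n, hn⟩ := pow_unbounded_of_one_lt (C / b) hr
  have h1 : (a / b) ^ n ≤ (a / b) ^ 2 ^ n := pow_le_pow_right₀ hr.le n.lt_two_pow_self.le
  have h2 : (a / b) ^ 2 ^ n ≤ C / b := by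
    rw [div_pow, div_le_div_iff₀ (by positivity) hb]
    calc _ ≤ C * b ^ (2 ^ n - 1) * b := by gcongr; exact h n
      _ = _ := by rw [mul_assoc, ← pow_succ, Nat.sub_add_cancel Nat.one_le_two_pow]
  linarith

namespace Correspondence

variable {A E : Type*} [NonUnitalCStarAlgebra A] [NormedAddCommGroup E]
    [NormedSpace ℂ E] [CompleteSpace E] [Correspondence A E]

theorem IsAdjointPair.symm {T S : E →L[ℂ] E} (h : IsAdjointPair A T S) : IsAdjointPair A S T := by
  intro x y
  rw [← star_inner, ← h, star_inner]

theorem IsAdjointPair.norm_le {T S : E →L[ℂ] E} (h : IsAdjointPair A T S) : ‖S‖ ≤ ‖T‖ := by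
  refine S.opNorm_le_bound (norm_nonneg _) fun y => ?_
  have h1 : ‖S y‖ * ‖S y‖ ≤ (‖T‖ * ‖y‖) * ‖S y‖ := by
    rw [← sq, norm_sq (A := A), ← h (S y) y, mul_assoc, mul_comm ‖y‖, ← mul_assoc]
    refine (norm_inner_le _ _).trans ?_
    gcongr
    exact T.le_opNorm _
  by_cases h0 : ‖S y‖ = 0
  · rw [h0]; positivity
  · exact le_of_mul_le_mul_right h1 (lt_of_le_of_ne (norm_nonneg _) (Ne.symm h0))

theorem isAdjointPair_theta (ξ η : E) : IsAdjointPair A (theta A ξ η) (theta A η ξ) := by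
  intro x y
  change inner (right ξ (inner η x)) y = inner x (right η (inner ξ y))
  rw [inner_right_left, inner_right, star_inner]

end Correspondence

open Correspondence

/-- A product system over `ℕ^k` of `A`-correspondences: fibres `X m`, an associative multiplication
`mul : X m × X n → X p` for `m + n = p`, and an identification `unit` of `A` (as an
`A`-correspondence) with the fibre over `0`, under which multiplication by elements of the zero
fibre is given by the two actions of `A`.  `inner_mul` and `dense_mul` say that for `m, n ≠ 0` the
multiplication implements an isomorphism `X m ⊗_A X n ≅ X (m + n)`; compatibility with the actions
follows from associativity. -/
structure ProductSystem.{u} (k : ℕ) (A : Type u) [NonUnitalCStarAlgebra A] where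
  X : (Fin k → ℕ) → Type u
  [normedAddCommGroup : ∀ m, NormedAddCommGroup (X m)]
  [normedSpace : ∀ m, NormedSpace ℂ (X m)]
  [completeSpace : ∀ m, CompleteSpace (X m)]
  [correspondence : ∀ m, Correspondence A (X m)]
  mul : ∀ {m n p : Fin k → ℕ}, m + n = p → X m →ₗ[ℂ] X n →ₗ[ℂ] X p
  unit : A ≃ₗ[ℂ] X 0
  mul_assoc : ∀ {l m n p q r : Fin k → ℕ} (h₁ : l + m = p) (h₂ : p + n = r) (h₃ : m + n = q)
    (h₄ : l + q = r) (x : X l) (y : X m) (z : X n),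
    mul h₂ (mul h₁ x y) z = mul h₄ x (mul h₃ y z)
  inner_unit : ∀ a b : A, inner (unit a) (unit b) = star a * b
  right_unit : ∀ a b : A, right (unit a) b = unit (a * b)
  left_unit : ∀ a b : A, left a (unit b) = unit (a * b)
  unit_mul : ∀ {m : Fin k → ℕ} (a : A) (x : X m), mul (zero_add m) (unit a) x = left a x
  mul_unit : ∀ {m : Fin k → ℕ} (x : X m) (a : A), mul (add_zero m) x (unit a) = right x a
  inner_mul : ∀ {m n p : Fin k → ℕ} (h : m + n = p) (x x' : X m) (y y' : X n),
    inner (A := A) (mul h x y) (mul h x' y') = inner y (left (inner (A := A) x x') y')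
  dense_mul : ∀ {m n p : Fin k → ℕ} (h : m + n = p), m ≠ 0 → n ≠ 0 →
    (Submodule.span ℂ {z : X p | ∃ x y, mul h x y = z}).topologicalClosure = ⊤

namespace ProductSystem

attribute [instance] ProductSystem.normedAddCommGroup ProductSystem.normedSpace
  ProductSystem.completeSpace ProductSystem.correspondence

universe u v

variable {k : ℕ} {A : Type u} [NonUnitalCStarAlgebra A] (X : ProductSystem k A)

/-- The homomorphism `φ_m : A → L(X_m)` implementing the left action. -/
abbrev phi (m : Fin k → ℕ) : A →ₙₐ[ℂ] (X.X m →L[ℂ] X.X m) := left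

/-- The generalized compact operators on the fibre over `m`. -/
abbrev K (m : Fin k → ℕ) : Submodule ℂ (X.X m →L[ℂ] X.X m) := compacts A (X.X m)

/-- `S = ι_p^q(T)`: for `0 ≠ p ≤ q` this means `S(ξη) = T(ξ)η` for `ξ ∈ X_p`, `η ∈ X_{q-p}`; for
`p = 0` the operator `T` is the action of some `a ∈ A ≅ K(X_0)` and `S = φ_q(a)`. -/
def IsInduced (p q : Fin k → ℕ) (T : X.X p →L[ℂ] X.X p) (S : X.X q →L[ℂ] X.X q) : Prop :=
  p ≤ q ∧
    (p = 0 → ∃ a, T = X.phi p a ∧ S = X.phi q a) ∧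
    (p ≠ 0 → ∀ (t : Fin k → ℕ) (h : p + t = q) (ξ : X.X p) (η : X.X t),
      S (X.mul h ξ η) = X.mul h (T ξ) η)

open scoped Classical in
/-- The operator `ι_p^q(T)`, with `ι_p^q(T) = 0` unless `p ≤ q`. -/
def iota (p q : Fin k → ℕ) (T : X.X p →L[ℂ] X.X p) : X.X q →L[ℂ] X.X q :=
  if h : ∃ S, X.IsInduced p q T S then h.choose else 0

/-- Compact alignment: `ι_p^{p∨q}(S) ι_q^{p∨q}(T)` is compact for compact `S`, `T`. In `ℕ^k` any two
elements have the least upper bound `p ⊔ q`. -/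
def CompactlyAligned : Prop :=
  ∀ (p q : Fin k → ℕ), ∀ S ∈ X.K p, ∀ T ∈ X.K q,
    X.iota p (p ⊔ q) S * X.iota q (p ⊔ q) T ∈ X.K (p ⊔ q)

/-- The ideal `I_p = ⋂_{0 < r ≤ p} ker φ_r`, which is `A` for `p = 0`. -/
def kerIdeal (p : Fin k → ℕ) : Set A := {a | ∀ r, r ≠ 0 → r ≤ p → X.phi r a = 0}

/-- `X_p · I` for an ideal `I` of `A`: the closed span of the products `ξ · a`, `a ∈ I`. -/
def fibreIdeal (p : Fin k → ℕ) (I : Set A) : Submodule ℂ (X.X p) :=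
  (Submodule.span ℂ {z | ∃ ξ : X.X p, ∃ a ∈ I, right ξ a = z}).topologicalClosure

/-- The space `X̃_q = ⨁_{p ≤ q} X_p · I_{q-p}`. -/
def tilde (q : Fin k → ℕ) : Submodule ℂ (∀ p : Set.Iic q, X.X p.1) :=
  Submodule.pi Set.univ fun p => X.fibreIdeal p.1 (X.kerIdeal (q - p.1))

/-- The left action `φ̃_q(a)`, `(φ̃_q(a) ξ)(p) = φ_p(a) ξ(p)`, as a map on `X̃_q`. -/
def tildePhi (q : Fin k → ℕ) (a : A) (ξ : X.tilde q) : ∀ p : Set.Iic q, X.X p.1 :=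
  fun p => X.phi p.1 a (ξ.1 p)

/-- The operator `ι̃_p^q(S)`, `(ι̃_p^q(S) ξ)(r) = ι_p^r(S) ξ(r)`, as a map on `X̃_q`. -/
def tildeIota (p q : Fin k → ℕ) (S : X.X p →L[ℂ] X.X p) (ξ : X.tilde q) :
    ∀ r : Set.Iic q, X.X r.1 :=
  fun r => X.iota p r.1 S (ξ.1 r)

/-- A (Toeplitz) representation of `X` in the `C*`-algebra `B`; `base` is `ψ_e : A → B`. -/
structure ToeplitzRep (B : Type v) [NonUnitalCStarAlgebra B] where
  toFun : ∀ m, X.X m →ₗ[ℂ] B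
  base : A →⋆ₙₐ[ℂ] B
  map_unit : ∀ a, toFun 0 (X.unit a) = base a
  map_right : ∀ {m} (ξ : X.X m) (a : A), toFun m (right ξ a) = toFun m ξ * base a
  map_inner : ∀ {m} (ξ η : X.X m), star (toFun m ξ) * toFun m η = base (inner ξ η)
  map_left : ∀ {m} (a : A) (ξ : X.X m), toFun m (left a ξ) = base a * toFun m ξ
  map_mul : ∀ {m n p : Fin k → ℕ} (h : m + n = p) (ξ : X.X m) (η : X.X n),
    toFun p (X.mul h ξ η) = toFun m ξ * toFun n η

namespace ToeplitzRep

variable {X} {B : Type v} [NonUnitalCStarAlgebra B] (ψ : X.ToeplitzRep B)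

theorem norm_apply_le {m} (ξ : X.X m) : ‖ψ.toFun m ξ‖ ≤ ‖ξ‖ := by
  refine le_of_sq_le_sq ?_ (norm_nonneg _)
  rw [sq ‖ψ.toFun m ξ‖, ← CStarRing.norm_star_mul_self, ψ.map_inner, norm_sq (A := A) ξ]
  exact NonUnitalStarAlgHom.norm_apply_le ψ.base _

/-- `x ↦ ∑ c Θ_{ξ,η}` -/
def thetaComb (m : Fin k → ℕ) : (X.X m × X.X m →₀ ℂ) →ₗ[ℂ] (X.X m →L[ℂ] X.X m) :=
  Finsupp.linearCombination ℂ fun p => theta A p.1 p.2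

/-- `x ↦ ∑ c ψ(ξ)ψ(η)^*` -/
def repComb (m : Fin k → ℕ) : (X.X m × X.X m →₀ ℂ) →ₗ[ℂ] B :=
  Finsupp.linearCombination ℂ fun p => ψ.toFun m p.1 * star (ψ.toFun m p.2)

theorem repComb_mul {m} (x : X.X m × X.X m →₀ ℂ) (ζ : X.X m) :
    ψ.repComb m x * ψ.toFun m ζ = ψ.toFun m (thetaComb m x ζ) := by
  induction x using Finsupp.induction_linear with
  | zero => simp
  | add x y hx hy => simp [add_mul, hx, hy]
  | single p c =>
    simp only [repComb, thetaComb, Finsupp.linearCombination_single, smul_mul_assoc,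
      _root_.smul_apply, map_smul]
    rw [_root_.mul_assoc, ψ.map_inner, ← ψ.map_right]
    rfl

theorem exists_adjoint {m} (x : X.X m × X.X m →₀ ℂ) : ∃ y : X.X m × X.X m →₀ ℂ,
    IsAdjointPair A (thetaComb m x) (thetaComb m y) ∧ ψ.repComb m y = star (ψ.repComb m x) := by
  induction x using Finsupp.induction_linear with
  | zero =>
    refine ⟨0, fun x y => ?_, by simp⟩
    have h : ∀ z : X.X m, inner (A := A) z 0 = 0 := fun z => by
      simpa using Correspondence.inner_smul_right (A := A) 0 z 0
    have h' : ∀ z : X.X m, inner (A := A) 0 z = 0 := fun z => by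
      rw [← Correspondence.star_inner, h, star_zero]
    simp [h, h']
  | add x y hx hy =>
    obtain ⟨x', hx1, hx2⟩ := hx
    obtain ⟨y', hy1, hy2⟩ := hy
    refine ⟨x' + y', fun u v => ?_, by simp [hx2, hy2]⟩
    simp only [map_add, _root_.add_apply, Correspondence.inner_add_left,
      Correspondence.inner_add_right]
    rw [hx1, hy1]
  | single p c =>
    refine ⟨Finsupp.single (p.2, p.1) (star c), fun u v => ?_, by simp [repComb]⟩
    simp only [thetaComb, Finsupp.linearCombination_single, _root_.smul_apply,
      Correspondence.inner_smul_left, Correspondence.inner_smul_right]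
    rw [isAdjointPair_theta]

theorem norm_repComb_le_of_isSelfAdjoint {m} (h : B) (hs : IsSelfAdjoint h)
    (S : X.X m →L[ℂ] X.X m) (hS : ∀ ζ, h * ψ.toFun m ζ = ψ.toFun m (S ζ))
    (x : X.X m × X.X m →₀ ℂ) (T : B) (hx : h = ψ.repComb m x * T) : ‖h‖ ≤ ‖S‖ := by
  have hpow : ∀ n, ‖S ^ n‖ ≤ ‖S‖ ^ n := by
    intro n
    induction n with
    | zero => rw [pow_zero, pow_zero]; exact ContinuousLinearMap.norm_id_le
    | succ n ih =>
      rw [pow_succ, pow_succ]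
      exact (norm_mul_le _ _).trans (by gcongr)
  let H : ℕ → B := fun n => (fun b => h * b)^[n] h
  have H0 : H 0 = h := rfl
  have Hs : ∀ n, H (n + 1) = h * H n := fun n => Function.iterate_succ_apply' _ _ _
  have Hadd : ∀ m n, H m * H n = H (m + n + 1) := by
    intro m n
    induction m with
    | zero => rw [H0, zero_add, Hs]
    | succ m ih => rw [Hs, _root_.mul_assoc, ih, ← Hs]; congr 1; omega
  have Hsa : ∀ n, IsSelfAdjoint (H n) := by
    intro n
    induction n with
    | zero => exact hs
    | succ n ih =>
      rw [isSelfAdjoint_iff, Hs, star_mul, hs.star_eq, ih.star_eq, ← Hs, ← H0, Hadd]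
  have Hnorm : ∀ j : ℕ, ‖H (2 ^ j - 1)‖ = ‖h‖ ^ 2 ^ j := by
    intro j
    induction j with
    | zero => simp [H0]
    | succ j ih =>
      have e : 2 ^ (j + 1) - 1 = (2 ^ j - 1) + (2 ^ j - 1) + 1 := by
        have := Nat.one_le_two_pow (n := j)
        rw [pow_succ]; omega
      rw [e, ← Hadd]
      have := CStarRing.norm_star_mul_self (x := H (2 ^ j - 1))
      rw [(Hsa _).star_eq] at this
      rw [this, ih, pow_succ, pow_mul, sq]
  have key : ∀ x : X.X m × X.X m →₀ ℂ, ∃ C : ℝ, 0 ≤ C ∧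
      ∀ n, ‖(fun b => h * b)^[n] (ψ.repComb m x)‖ ≤ C * ‖S‖ ^ n := by
    intro x
    induction x using Finsupp.induction_linear with
    | zero =>
      refine ⟨0, le_rfl, fun n => ?_⟩
      have : (fun b => h * b)^[n] (0 : B) = 0 := by
        induction n with
        | zero => rfl
        | succ n ih => rw [Function.iterate_succ_apply', ih, mul_zero]
      simp [this]
    | add x y hx hy =>
      obtain ⟨C, hC, h1⟩ := hx
      obtain ⟨D, hD, h2⟩ := hy
      refine ⟨C + D, by positivity, fun n => ?_⟩
      have : (fun b => h * b)^[n] (ψ.repComb m (x + y)) =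
          (fun b => h * b)^[n] (ψ.repComb m x) + (fun b => h * b)^[n] (ψ.repComb m y) := by
        induction n with
        | zero => simp
        | succ n ih => simp only [Function.iterate_succ_apply', ih, mul_add]
      rw [this, add_mul]
      exact (norm_add_le _ _).trans (add_le_add (h1 n) (h2 n))
    | single p c =>
      refine ⟨‖c‖ * (‖p.1‖ * ‖p.2‖), by positivity, fun n => ?_⟩
      have : (fun b => h * b)^[n] (ψ.repComb m (Finsupp.single p c)) =
          c • (ψ.toFun m ((S ^ n) p.1) * star (ψ.toFun m p.2)) := by
        induction n with
        | zero => simp [repComb]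
        | succ n ih =>
          rw [Function.iterate_succ_apply', ih, mul_smul_comm, ← _root_.mul_assoc, hS, pow_succ']
          rfl
      rw [this, norm_smul, _root_.mul_assoc]
      gcongr
      refine (norm_mul_le _ _).trans ?_
      rw [norm_star]
      calc _ ≤ (‖S‖ ^ n * ‖p.1‖) * ‖p.2‖ := by
            gcongr
            · refine (ψ.norm_apply_le _).trans (((S ^ n).le_opNorm _).trans ?_)
              gcongr
              exact hpow n
            · exact ψ.norm_apply_le _
        _ = _ := by ring
  obtain ⟨C, hC, hC'⟩ := key x
  have hH : ∀ n, H n = (fun b => h * b)^[n] (ψ.repComb m x) * T := by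
    intro n
    induction n with
    | zero => exact hx
    | succ n ih => rw [Hs, ih, Function.iterate_succ_apply', _root_.mul_assoc]
  refine le_of_pow_two_pow_le (C := C * ‖T‖) (norm_nonneg _) fun j => ?_
  rw [← Hnorm, hH]
  refine (norm_mul_le _ _).trans ?_
  calc _ ≤ (C * ‖S‖ ^ (2 ^ j - 1)) * ‖T‖ := by gcongr; exact hC' _
    _ = _ := by ring

theorem norm_repComb_le {m} (x : X.X m × X.X m →₀ ℂ) :
    ‖ψ.repComb m x‖ ≤ ‖thetaComb m x‖ := by
  obtain ⟨y, hy, hxy⟩ := ψ.exists_adjoint x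
  have h := ψ.norm_repComb_le_of_isSelfAdjoint (ψ.repComb m x * star (ψ.repComb m x))
    (IsSelfAdjoint.mul_star_self _) (thetaComb m x * thetaComb m y)
    (fun ζ => by
      rw [← hxy, _root_.mul_assoc, repComb_mul, repComb_mul]; rfl) x _ rfl
  rw [CStarRing.norm_self_mul_star] at h
  refine abs_le_of_sq_le_sq' ?_ (norm_nonneg _) |>.2
  rw [sq, sq]
  exact h.trans ((norm_mul_le _ _).trans (by gcongr; exact hy.norm_le))

theorem exists_compactMap (m : Fin k → ℕ) : ∃ F : X.K m →L[ℂ] B,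
    ∀ ξ η : X.X m, ∀ h : theta A ξ η ∈ X.K m,
      F ⟨theta A ξ η, h⟩ = ψ.toFun m ξ * star (ψ.toFun m η) := by
  have hb := NormedSpace.toIsBoundedSMul (𝕜 := ℂ) (E := X.K m)
  have hmem : ∀ x, thetaComb m x ∈ X.K m := fun x =>
    Submodule.le_topologicalClosure _ (by
      rw [← Finsupp.range_linearCombination]; exact ⟨x, rfl⟩)
  let e : (X.X m × X.X m →₀ ℂ) →ₗ[ℂ] X.K m := (thetaComb m).codRestrict _ hmem
  have hd : DenseRange e := by
    intro T
    have hT : (T : X.X m →L[ℂ] X.X m) ∈ closure (Set.range (thetaComb (X := X) m)) := by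
      have : (T : X.X m →L[ℂ] X.X m) ∈ (Submodule.span ℂ (Set.range
        fun p : X.X m × X.X m => theta A p.1 p.2)).topologicalClosure := T.2
      rw [← Finsupp.range_linearCombination] at this
      exact this
    rw [closure_subtype]
    convert hT using 2
    ext S
    constructor
    · rintro ⟨_, ⟨x, rfl⟩, rfl⟩; exact ⟨x, rfl⟩
    · rintro ⟨x, rfl⟩; exact ⟨e x, ⟨x, rfl⟩, rfl⟩
  refine ⟨(ψ.repComb m).extendOfNorm e, fun ξ η h => ?_⟩
  have := LinearMap.extendOfNorm_eq (f := ψ.repComb m) hd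
    ⟨1, fun x => by rw [one_mul]; exact ψ.norm_repComb_le x⟩ (Finsupp.single (ξ, η) 1)
  simp only [repComb, Finsupp.linearCombination_single, one_smul] at this
  have he : e (Finsupp.single (ξ, η) 1) = ⟨theta A ξ η, h⟩ := by
    ext1
    simp [e, thetaComb]
  rw [he] at this
  exact this

open scoped Classical in
/-- The map `ψ^{(m)} : K(X_m) → B` with `ψ^{(m)}(Θ_{ξ,η}) = ψ(ξ)ψ(η)^*`, extended by `0` to operators
that are not compact. -/
def compactMap (m : Fin k → ℕ) (T : X.X m →L[ℂ] X.X m) : B :=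
  if h : T ∈ X.K m then (ψ.exists_compactMap m).choose ⟨T, h⟩ else 0

end ToeplitzRep

/-- Cuntz-Pimsner covariance in the sense of Katsura (CP-K): `ψ^{(m)}(φ_m(a)) = ψ_e(a)` whenever
`φ_m(a)` is compact and `a ∈ (ker φ_m)^⊥`. -/
def IsCPK (B : Type v) [NonUnitalCStarAlgebra B] (ψ : X.ToeplitzRep B) : Prop :=
  ∀ (m : Fin k → ℕ) (a : A), X.phi m a ∈ X.K m → (∀ b, X.phi m b = 0 → a * b = 0) →
    ψ.compactMap m (X.phi m a) = ψ.base a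

/-- Nica covariance (N). -/
def IsNicaCovariant (B : Type v) [NonUnitalCStarAlgebra B] (ψ : X.ToeplitzRep B) : Prop :=
  ∀ (p q : Fin k → ℕ), ∀ S ∈ X.K p, ∀ T ∈ X.K q,
    ψ.compactMap p S * ψ.compactMap q T =
      ψ.compactMap (p ⊔ q) (X.iota p (p ⊔ q) S * X.iota q (p ⊔ q) T)

/-- `P s` holds for large `s`: every `q` is dominated by some `r` such that `P` holds above `r`. -/
def ForLarge (P : (Fin k → ℕ) → Prop) : Prop := ∀ q, ∃ r, q ≤ r ∧ ∀ s, r ≤ s → P s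

/-- Cuntz-Pimsner covariance in the sense of Sims and Yeend (CP-SY). -/
def IsCPSY (B : Type v) [NonUnitalCStarAlgebra B] (ψ : X.ToeplitzRep B) : Prop :=
  ∀ (F : Finset (Fin k → ℕ)) (T : ∀ p, X.X p →L[ℂ] X.X p), (∀ p ∈ F, T p ∈ X.K p) →
    ForLarge (fun s => ∑ p ∈ F, X.tildeIota p s (T p) = 0) →
    ∑ p ∈ F, ψ.compactMap p (T p) = 0

/-- Cuntz-Nica-Pimsner covariance: (CP-SY) and (N). -/
def IsCNP (B : Type v) [NonUnitalCStarAlgebra B] (ψ : X.ToeplitzRep B) : Prop :=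
  X.IsCPSY B ψ ∧ X.IsNicaCovariant B ψ

section Universal

/-- A representation of `X`, in some `C*`-algebra, that has the property `P`. -/
structure RepWith (P : ∀ (B : Type u) [NonUnitalCStarAlgebra B], X.ToeplitzRep B → Prop) where
  B : Type u
  [cstar : NonUnitalCStarAlgebra B]
  rep : X.ToeplitzRep B
  prop : P B rep

attribute [instance] RepWith.cstar

variable (P : ∀ (B : Type u) [NonUnitalCStarAlgebra B], X.ToeplitzRep B → Prop)

/-- The `ℓ^∞`-product of the targets of all representations of `X` with the property `P`. -/
abbrev Ambient := lp (fun i : X.RepWith P => i.B) ∞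

/-- The element `(ψ(ξ))_ψ` of the product. -/
def gen (m : Fin k → ℕ) (ξ : X.X m) : X.Ambient P :=
  ⟨fun i => i.rep.toFun m ξ, memℓp_infty ⟨‖ξ‖, by
    rintro _ ⟨i, rfl⟩
    exact i.rep.norm_apply_le ξ⟩⟩

/-- The closed `*`-subalgebra of the product generated by the elements `(ψ(ξ))_ψ`. -/
def univSubalgebra : NonUnitalStarSubalgebra ℂ (X.Ambient P) :=
  (NonUnitalStarAlgebra.adjoin ℂ {z | ∃ m ξ, X.gen P m ξ = z}).topologicalClosure

/-- The universal `C*`-algebra generated by a representation of `X` with the property `P`. -/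
def UnivAlg : Type (u + 1) := X.univSubalgebra P

instance : NonUnitalCStarAlgebra (X.UnivAlg P) :=
  have : IsClosed (X.univSubalgebra P : Set (X.Ambient P)) :=
    NonUnitalStarSubalgebra.isClosed_topologicalClosure _
  inferInstanceAs (NonUnitalCStarAlgebra (X.univSubalgebra P))

theorem gen_mem (m : Fin k → ℕ) (ξ : X.X m) : X.gen P m ξ ∈ X.univSubalgebra P :=
  NonUnitalStarSubalgebra.le_topologicalClosure _
    (NonUnitalStarAlgebra.subset_adjoin ℂ _ ⟨m, ξ, rfl⟩)

/-- The universal representation of `X` with the property `P`. -/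
def univRep : X.ToeplitzRep (X.UnivAlg P) where
  toFun m :=
    { toFun := fun ξ => ⟨X.gen P m ξ, X.gen_mem P m ξ⟩
      map_add' := fun ξ η => Subtype.ext <| lp.ext <| funext fun i => map_add (i.rep.toFun m) ξ η
      map_smul' := fun c ξ => Subtype.ext <| lp.ext <| funext fun i =>
        map_smul (i.rep.toFun m) c ξ }
  base :=
    { toFun := fun a => ⟨X.gen P 0 (X.unit a), X.gen_mem P 0 _⟩
      map_smul' := fun c a => Subtype.ext <| lp.ext <| funext fun i => by
        change i.rep.toFun 0 (X.unit (c • a)) = c • i.rep.toFun 0 (X.unit a)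
        rw [map_smul, map_smul]
      map_zero' := Subtype.ext <| lp.ext <| funext fun i => by
        change i.rep.toFun 0 (X.unit 0) = 0
        rw [map_zero, map_zero]
      map_add' := fun a b => Subtype.ext <| lp.ext <| funext fun i => by
        change i.rep.toFun 0 (X.unit (a + b)) =
          i.rep.toFun 0 (X.unit a) + i.rep.toFun 0 (X.unit b)
        rw [map_add, map_add]
      map_mul' := fun a b => Subtype.ext <| lp.ext <| funext fun i => by
        change i.rep.toFun 0 (X.unit (a * b)) =
          i.rep.toFun 0 (X.unit a) * i.rep.toFun 0 (X.unit b)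
        rw [i.rep.map_unit, i.rep.map_unit, i.rep.map_unit, map_mul]
      map_star' := fun a => Subtype.ext <| lp.ext <| funext fun i => by
        change i.rep.toFun 0 (X.unit (star a)) = star (i.rep.toFun 0 (X.unit a))
        rw [i.rep.map_unit, i.rep.map_unit, map_star] }
  map_unit a := rfl
  map_right ξ a := Subtype.ext <| lp.ext <| funext fun i => by
    change i.rep.toFun _ (right ξ a) = i.rep.toFun _ ξ * i.rep.toFun 0 (X.unit a)
    rw [i.rep.map_right, i.rep.map_unit]
  map_inner ξ η := Subtype.ext <| lp.ext <| funext fun i => by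
    change star (i.rep.toFun _ ξ) * i.rep.toFun _ η = i.rep.toFun 0 (X.unit (inner ξ η))
    rw [i.rep.map_inner, i.rep.map_unit]
  map_left a ξ := Subtype.ext <| lp.ext <| funext fun i => by
    change i.rep.toFun _ (left a ξ) = i.rep.toFun 0 (X.unit a) * i.rep.toFun _ ξ
    rw [i.rep.map_left, i.rep.map_unit]
  map_mul h ξ η := Subtype.ext <| lp.ext <| funext fun i => i.rep.map_mul h ξ η

/-- The universal algebra maps to the target of each representation with the property `P`. -/
def univHom (i : X.RepWith P) : X.UnivAlg P →⋆ₙₐ[ℂ] i.B where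
  toFun z := z.1 i
  map_smul' _ _ := rfl
  map_zero' := rfl
  map_add' _ _ := rfl
  map_mul' _ _ := rfl
  map_star' _ := rfl

theorem univHom_univRep (i : X.RepWith P) (m : Fin k → ℕ) (ξ : X.X m) :
    X.univHom P i ((X.univRep P).toFun m ξ) = i.rep.toFun m ξ := rfl

end Universal

/-- The Cuntz-Pimsner algebra `O_X`, universal for representations satisfying (CP-K). -/
abbrev CuntzPimsner : Type (u + 1) := X.UnivAlg X.IsCPK

/-- The universal representation `j^{Fow}` of `X` in `O_X`. -/
abbrev jFow : X.ToeplitzRep X.CuntzPimsner := X.univRep X.IsCPK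

/-- The Cuntz-Nica-Pimsner algebra `NO_X`, universal for CNP-covariant representations. -/
abbrev CuntzNicaPimsner : Type (u + 1) := X.UnivAlg X.IsCNP

/-- The universal representation `j^{CNP}` of `X` in `NO_X`. -/
abbrev jCNP : X.ToeplitzRep X.CuntzNicaPimsner := X.univRep X.IsCNP

end ProductSystem

namespace ProductSystem

universe u v

variable {k : ℕ} {A : Type u} [NonUnitalCStarAlgebra A] (X : ProductSystem k A)

/-- The maps `ψ^{(m)}` are natural in the target. -/
theorem ToeplitzRep.map_compactMap {X : ProductSystem k A} {B C : Type*} [NonUnitalCStarAlgebra B]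
    [NonUnitalCStarAlgebra C] (ψ : X.ToeplitzRep B) (χ : X.ToeplitzRep C) (f : B →⋆ₙₐ[ℂ] C)
    (hf : ∀ m ξ, f (ψ.toFun m ξ) = χ.toFun m ξ) (m : Fin k → ℕ) (T : X.X m →L[ℂ] X.X m) :
    f (ψ.compactMap m T) = χ.compactMap m T := by
  by_cases hT : T ∈ X.K m
  · rw [compactMap, compactMap, dif_pos hT, dif_pos hT]
    have h1 := (ψ.exists_compactMap m).choose_spec
    have h2 := (χ.exists_compactMap m).choose_spec
    set F := (ψ.exists_compactMap m).choose
    set G := (χ.exists_compactMap m).choose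
    have hfc : Continuous f :=
      AddMonoidHomClass.continuous_of_bound f 1 fun x => by
        rw [one_mul]; exact NonUnitalStarAlgHom.norm_apply_le f x
    suffices h : ∀ S (hS : S ∈ X.K m), f (F ⟨S, hS⟩) = G ⟨S, hS⟩ from h T hT
    intro S hS
    have hle : Submodule.span ℂ (Set.range fun p : X.X m × X.X m => theta A p.1 p.2) ≤ X.K m :=
      Submodule.le_topologicalClosure _
    have hspan : ∀ S (hS : S ∈ Submodule.span ℂ
        (Set.range fun p : X.X m × X.X m => theta A p.1 p.2)),
        f (F ⟨S, hle hS⟩) = G ⟨S, hle hS⟩ := by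
      intro S hS
      induction hS using Submodule.span_induction with
      | mem S h =>
        obtain ⟨p, rfl⟩ := h
        rw [h1, h2, _root_.map_mul, map_star, hf, hf]
      | zero => exact (congrArg f (map_zero F)).trans ((map_zero f).trans (map_zero G).symm)
      | add S T hS hT h h' =>
        have e : (⟨S + T, hle (add_mem hS hT)⟩ : X.K m) = ⟨S, hle hS⟩ + ⟨T, hle hT⟩ := rfl
        rw [e, map_add, map_add, map_add, h, h']
      | smul c S hS h =>
        have e : (⟨c • S, hle (Submodule.smul_mem _ c hS)⟩ : X.K m) = c • ⟨S, hle hS⟩ := rfl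
        rw [e, map_smul, map_smul, map_smul, h]
    have hcl : IsClosed {S : X.K m | f (F S) = G S} :=
      isClosed_eq (hfc.comp F.continuous) G.continuous
    have hS' : S ∈ closure (Submodule.span ℂ
        (Set.range fun p : X.X m × X.X m => theta A p.1 p.2) : Set (X.X m →L[ℂ] X.X m)) := hS
    have hsub : (Submodule.span ℂ (Set.range fun p : X.X m × X.X m => theta A p.1 p.2) :
        Set (X.X m →L[ℂ] X.X m)) ⊆ Subtype.val '' {S : X.K m | f (F S) = G S} :=
      fun S h => ⟨⟨S, hle h⟩, hspan S h, rfl⟩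
    exact hcl.closure_subset (closure_subtype.2 (closure_mono hsub hS'))
  · unfold compactMap
    rw [dif_neg hT, dif_neg hT, map_zero]

theorem univHom_compactMap (P : ∀ (B : Type u) [NonUnitalCStarAlgebra B], X.ToeplitzRep B → Prop)
    (i : X.RepWith P) (m : Fin k → ℕ) (T : X.X m →L[ℂ] X.X m) :
    X.univHom P i ((X.univRep P).compactMap m T) = i.rep.compactMap m T :=
  ToeplitzRep.map_compactMap _ _ _ (fun _ _ => rfl) m T

theorem univ_ext (P : ∀ (B : Type u) [NonUnitalCStarAlgebra B], X.ToeplitzRep B → Prop)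
    {z w : X.UnivAlg P} (h : ∀ i, X.univHom P i z = X.univHom P i w) : z = w :=
  Subtype.ext (lp.ext (funext h))

/-- The universal representation in `O_X` is itself covariant. -/
theorem isCPK_jFow : X.IsCPK _ X.jFow := fun m a h h' =>
  X.univ_ext _ fun i => (X.univHom_compactMap _ i m _).trans
    ((i.prop m a h h').trans ((i.rep.map_unit a).symm))

/-- The universal representation in `NO_X` is itself covariant. -/
theorem isCNP_jCNP : X.IsCNP _ X.jCNP := by
  refine ⟨fun F T hT hF => X.univ_ext _ fun i => ?_, fun p q S hS T hT => X.univ_ext _ fun i => ?_⟩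
  · rw [map_sum, map_zero]
    simp only [univHom_compactMap]
    exact i.prop.1 F T hT hF
  · rw [map_mul]
    simp only [univHom_compactMap]
    exact i.prop.2 p q S hS T hT

/-- Every representation with the property `P` factors uniquely through the universal one. -/
theorem existsUnique_univHom
    (P : ∀ (B : Type u) [NonUnitalCStarAlgebra B], X.ToeplitzRep B → Prop)
    (B : Type u) [NonUnitalCStarAlgebra B] (ψ : X.ToeplitzRep B) (hψ : P B ψ) :
    ∃! f : X.UnivAlg P →⋆ₙₐ[ℂ] B, ∀ m ξ, f ((X.univRep P).toFun m ξ) = ψ.toFun m ξ := by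
  refine ⟨X.univHom P ⟨B, ψ, hψ⟩, fun _ _ => rfl, fun f hf => ?_⟩
  set g := X.univHom P ⟨B, ψ, hψ⟩ with hg
  have hc : ∀ f : X.UnivAlg P →⋆ₙₐ[ℂ] B, Continuous f := fun f =>
    AddMonoidHomClass.continuous_of_bound f 1 fun x => by
      rw [one_mul]; exact NonUnitalStarAlgHom.norm_apply_le f x
  let s := {z | ∃ m ξ, X.gen P m ξ = z}
  have hle : NonUnitalStarAlgebra.adjoin ℂ s ≤ X.univSubalgebra P :=
    NonUnitalStarSubalgebra.le_topologicalClosure _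
  have hadj : ∀ z (hz : z ∈ NonUnitalStarAlgebra.adjoin ℂ s),
      f (⟨z, hle hz⟩ : X.univSubalgebra P) = g (⟨z, hle hz⟩ : X.univSubalgebra P) := by
    intro z hz
    induction hz using NonUnitalStarAlgebra.adjoin_induction with
    | mem z h =>
      obtain ⟨m, ξ, rfl⟩ := h
      exact hf m ξ
    | add z w hz hw h h' =>
      exact (map_add f (⟨z, hle hz⟩ : X.univSubalgebra P) (⟨w, hle hw⟩ : X.univSubalgebra P)).trans
        (congrArg₂ _ h h')
    | zero => exact (map_zero f).trans (map_zero g).symm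
    | mul z w hz hw h h' =>
      exact (map_mul f (⟨z, hle hz⟩ : X.univSubalgebra P) (⟨w, hle hw⟩ : X.univSubalgebra P)).trans
        (congrArg₂ _ h h')
    | smul c z hz h =>
      exact (map_smul f c (⟨z, hle hz⟩ : X.univSubalgebra P)).trans (congrArg (c • ·) h)
    | star z hz h =>
      exact (map_star f (⟨z, hle hz⟩ : X.univSubalgebra P)).trans (congrArg star h)
  refine NonUnitalStarAlgHom.ext fun z => ?_
  have hcl : IsClosed {z : X.univSubalgebra P | f z = g z} := isClosed_eq (hc f) (hc g)
  have hz : z.1 ∈ closure (NonUnitalStarAlgebra.adjoin ℂ s : Set (X.Ambient P)) := z.2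
  have hsub : (NonUnitalStarAlgebra.adjoin ℂ s : Set (X.Ambient P)) ⊆
      Subtype.val '' {z : X.univSubalgebra P | f z = g z} :=
    fun z h => ⟨⟨z, hle h⟩, hadj z h, rfl⟩
  exact hcl.closure_subset (closure_subtype.2 (closure_mono hsub hz))

end ProductSystem

section FibreSum

open Topology Filter

theorem finite_fibre {V E : Type*} [TopologicalSpace V] [T2Space V] [TopologicalSpace E]
    {s : E → V} (hs : IsLocalHomeomorph s) {K : Set E} (hK : IsCompact K) (v : V) :
    {y : E | y ∈ K ∧ s y = v}.Finite := by
  have hK' : IsCompact {y : E | y ∈ K ∧ s y = v} :=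
    hK.inter_right (isClosed_singleton.preimage hs.continuous)
  choose φ hφ hφs using hs
  obtain ⟨t, ht, hcov⟩ := hK'.elim_nhds_subcover (fun x => (φ x).source)
    fun x _ => (φ x).open_source.mem_nhds (hφ x)
  refine t.finite_toSet.subset fun y hy => ?_
  obtain ⟨x, hx, hyx⟩ := Set.mem_iUnion₂.1 (hcov hy)
  have : y = x := (φ x).injOn hyx (hφ x) (by
    rw [← hφs x, hy.2, (ht x hx).2])
  rw [this]
  exact hx

/-- The sum over the fibres of a local homeomorphism of a continuous function with compact support
is continuous. -/
theorem continuous_tsum_fibre {V E : Type*} [TopologicalSpace V] [T2Space V] [TopologicalSpace E]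
    [T2Space E] {s : E → V} (hs : IsLocalHomeomorph s) {f : E → ℂ} (hf : Continuous f)
    (hc : HasCompactSupport f) : Continuous fun v => ∑' e : {e // s e = v}, f e := by
  rw [continuous_iff_continuousAt]
  intro v₀
  have hfin := finite_fibre hs hc.isCompact v₀
  have hs' := hs.continuous
  choose φ hφ hφs using hs
  obtain ⟨U, hU, hdisj⟩ := hfin.t2_separation
  let F := {y : E // y ∈ tsupport f ∧ s y = v₀}
  have : Finite F := hfin
  have := Fintype.ofFinite F
  let O : F → Set E := fun y => (φ y).source ∩ U y
  have hO : ∀ y, IsOpen (O y) := fun y => (φ y).open_source.inter (hU y).2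
  have hO' : ∀ y : F, y.1 ∈ O y := fun y => ⟨hφ y, (hU y).1⟩
  let K' : Set E := tsupport f \ ⋃ y, O y
  have hK' : IsCompact K' := hc.isCompact.diff (isOpen_iUnion hO)
  have hsK' : IsClosed (s '' K') := (hK'.image hs').isClosed
  have hv₀ : v₀ ∉ s '' K' := by
    rintro ⟨y, ⟨hy1, hy2⟩, hy3⟩
    exact hy2 (Set.mem_iUnion.2 ⟨⟨y, hy1, hy3⟩, hO' _⟩)
  have htgt : ∀ y : F, v₀ ∈ (φ y).target := fun y => by
    have := (φ y).map_source (hφ y)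
    rwa [← hφs y, y.2.2] at this
  have hsymm : ∀ y : F, (φ y).symm v₀ = y := fun y => by
    have := (φ y).left_inv (hφ y)
    rwa [← hφs y, y.2.2] at this
  have hcont : ∀ y : F, ContinuousAt (φ y).symm v₀ := fun y =>
    (φ y).continuousAt_symm (htgt y)
  have hev : ∀ᶠ v in 𝓝 v₀, v ∉ s '' K' ∧ ∀ y : F, v ∈ (φ y).target ∧ (φ y).symm v ∈ O y := by
    have h1 : ∀ᶠ v in 𝓝 v₀, v ∉ s '' K' := hsK'.isOpen_compl.mem_nhds hv₀
    refine h1.and (Filter.eventually_all.2 fun y => ?_)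
    have h2 : ∀ᶠ v in 𝓝 v₀, v ∈ (φ y).target := (φ y).open_target.mem_nhds (htgt y)
    refine h2.and ((hcont y).eventually_mem ?_)
    rw [hsymm]
    exact (hO y).mem_nhds (hO' y)
  have heq : (fun v => ∑ y : F, f ((φ y).symm v)) =ᶠ[𝓝 v₀]
      fun v => ∑' e : {e // s e = v}, f e := by
    filter_upwards [hev] with v hv
    have hsv : ∀ y : F, s ((φ y).symm v) = v := fun y => by
      have := (φ y).right_inv (hv.2 y).1
      rwa [← hφs y] at this
    let g : F → {e // s e = v} := fun y => ⟨(φ y).symm v, hsv y⟩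
    have hg : Function.Injective g := by
      intro y y' h
      by_contra hne
      have h1 := (hv.2 y).2.2
      have h2 := (hv.2 y').2.2
      have e : (φ y).symm v = (φ y').symm v := congrArg Subtype.val h
      rw [e] at h1
      exact Set.disjoint_left.1 (hdisj y.2 y'.2 fun h => hne (Subtype.ext h)) h1 h2
    have hsupp : Function.support (fun e : {e // s e = v} => f e) ⊆ Set.range g := by
      rintro ⟨e, he⟩ hfe
      have h1 : e ∈ tsupport f := subset_tsupport _ hfe
      have h2 : e ∈ ⋃ y, O y := by
        by_contra h
        exact hv.1 ⟨e, ⟨h1, h⟩, he⟩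
      obtain ⟨y, hy⟩ := Set.mem_iUnion.1 h2
      refine ⟨y, Subtype.ext ?_⟩
      have := (φ y).left_inv hy.1
      rwa [← hφs y, he] at this
    rw [← hg.tsum_eq hsupp, tsum_fintype]
  refine ContinuousAt.congr ?_ heq
  refine tendsto_finsetSum _ fun y _ => ?_
  exact hf.continuousAt.comp (hcont y)

theorem tsum_fibre_eq_zero {V E : Type*} [TopologicalSpace E]
    {s : E → V} {f : E → ℂ} {v : V} (hv : v ∉ s '' tsupport f) :
    ∑' e : {e // s e = v}, f e = 0 := by
  have : (fun e : {e // s e = v} => f e) = 0 := by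
    funext e
    by_contra h
    exact hv ⟨e, subset_tsupport _ h, e.2⟩
  rw [this]
  exact tsum_zero

end FibreSum

/-- A topological graph with vertex space `V` and edge space `E`: a continuous range map and a
source map that is a local homeomorphism.  The spaces are locally compact Hausdorff wherever this is
used. -/
structure TopologicalGraph (V E : Type*) [TopologicalSpace V] [TopologicalSpace E] where
  r : E → V
  s : E → V
  continuous_r : Continuous r
  isLocalHomeomorph_s : IsLocalHomeomorph s

namespace TopologicalGraph

variable {V E : Type*} [TopologicalSpace V] [TopologicalSpace E] (G : TopologicalGraph V E)

/-- Families of square-summable functions on the fibres `s⁻¹(v)`, bounded in `v`.  The norm is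
`sup_v (∑_{s(e) = v} |ξ(e)|²)^{1/2}`. -/
abbrev Sections : Type _ := lp (fun v : V => lp (fun _ : {e // G.s e = v} => ℂ) 2) ∞

variable {G}

/-- An element of `Sections` as a function on the edges. -/
def Sections.ev (w : G.Sections) (e : E) : ℂ := w (G.s e) ⟨e, rfl⟩

theorem Sections.apply_eq (w : G.Sections) (v : V) (e : {e // G.s e = v}) : w v e = w.ev e := by
  obtain ⟨e, rfl⟩ := e
  rfl

theorem Sections.ext_ev {w w' : G.Sections} (h : ∀ e, w.ev e = w'.ev e) : w = w' := by
  refine lp.ext (funext fun v => lp.ext (funext fun e => ?_))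
  rw [w.apply_eq, w'.apply_eq, h]

variable (G)

/-- On each fibre of the source map the `ℓ²`-norm of `f` is at most `C`. -/
def FibreBound (f : E → ℂ) (C : ℝ) : Prop :=
  ∀ (v : V) (F : Finset E), (∀ e ∈ F, G.s e = v) → ∑ e ∈ F, ‖f e‖ ^ 2 ≤ C ^ 2

variable {G}

theorem FibreBound.sum_le {f : E → ℂ} {C : ℝ} (h : G.FibreBound f C) (v : V)
    (F : Finset {e // G.s e = v}) :
    ∑ e ∈ F, ‖f e‖ ^ (2 : ℝ≥0∞).toReal ≤ C ^ (2 : ℝ≥0∞).toReal := by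
  have := h v (F.map (Function.Embedding.subtype _)) (by
    intro e he
    obtain ⟨e', _, rfl⟩ := Finset.mem_map.1 he
    exact e'.2)
  simpa using this

/-- The section given by a function on the edges with bounded `ℓ²`-norms on the fibres. -/
def Sections.mk (f : E → ℂ) (C : ℝ) (hC : 0 ≤ C) (h : G.FibreBound f C) : G.Sections :=
  ⟨fun v => ⟨fun e => f e, memℓp_gen' (h.sum_le v)⟩, memℓp_infty ⟨C, by
    rintro _ ⟨v, rfl⟩
    exact lp.norm_le_of_forall_sum_le (by simp) hC (h.sum_le v)⟩⟩

theorem Sections.ev_mk (f : E → ℂ) (C : ℝ) (hC : 0 ≤ C) (h : G.FibreBound f C) (e : E) :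
    (Sections.mk f C hC h).ev e = f e := rfl

theorem Sections.norm_mk_le (f : E → ℂ) (C : ℝ) (hC : 0 ≤ C) (h : G.FibreBound f C) :
    ‖Sections.mk f C hC h‖ ≤ C :=
  lp.norm_le_of_forall_le hC fun v => lp.norm_le_of_forall_sum_le (by simp) hC (h.sum_le v)

theorem Sections.fibreBound (w : G.Sections) : G.FibreBound w.ev ‖w‖ := by
  classical
  intro v F hF
  have h1 := lp.sum_rpow_le_norm_rpow (by simp) (w v) (F.subtype fun e => G.s e = v)
  have h2 : ∑ e ∈ F.subtype (fun e => G.s e = v), ‖w v e‖ ^ (2 : ℝ≥0∞).toReal =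
      ∑ e ∈ F, ‖w.ev e‖ ^ 2 := by
    rw [← Finset.filter_true_of_mem hF, ← Finset.subtype_map, Finset.sum_map]
    refine Finset.sum_congr ?_ fun e _ => ?_
    · simp only [Finset.subtype_map, Finset.filter_true_of_mem hF]
    · rw [w.apply_eq]; simp
  rw [h2] at h1
  refine h1.trans ?_
  simp only [ENNReal.toReal_ofNat, Real.rpow_ofNat]
  gcongr
  exact lp.norm_apply_le_norm (by simp) w v

theorem FibreBound.mul {f h : E → ℂ} {C D : ℝ} (hf : G.FibreBound f C) (hh : ∀ e, ‖h e‖ ≤ D) :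
    G.FibreBound (fun e => h e * f e) (D * C) := by
  intro v F hF
  calc ∑ e ∈ F, ‖h e * f e‖ ^ 2 ≤ ∑ e ∈ F, D ^ 2 * ‖f e‖ ^ 2 := by
        refine Finset.sum_le_sum fun e _ => ?_
        rw [norm_mul, mul_pow]
        gcongr
        exact hh e
    _ ≤ D ^ 2 * C ^ 2 := by rw [← Finset.mul_sum]; gcongr; exact hf v F hF
    _ = _ := by ring

/-- Multiplication by a bounded function on the edges. -/
def Sections.mulByₗ (h : E → ℂ) (D : ℝ) (hD : 0 ≤ D) (hh : ∀ e, ‖h e‖ ≤ D) :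
    G.Sections →ₗ[ℂ] G.Sections where
  toFun w := Sections.mk (fun e => h e * w.ev e) (D * ‖w‖)
    (mul_nonneg hD (norm_nonneg _)) (w.fibreBound.mul hh)
  map_add' w w' := Sections.ext_ev fun e => mul_add (h e) (w.ev e) (w'.ev e)
  map_smul' c w := Sections.ext_ev fun e => mul_left_comm (h e) c (w.ev e)

theorem Sections.norm_mulByₗ_le (h : E → ℂ) (D : ℝ) (hD : 0 ≤ D) (hh : ∀ e, ‖h e‖ ≤ D)
    (w : G.Sections) : ‖Sections.mulByₗ h D hD hh w‖ ≤ D * ‖w‖ :=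
  Sections.norm_mk_le (fun e => h e * w.ev e) (D * ‖w‖) (mul_nonneg hD (norm_nonneg _))
    (w.fibreBound.mul hh)

/-- Multiplication by a bounded function on the edges. -/
def Sections.mulBy (h : E → ℂ) (D : ℝ) (hD : 0 ≤ D) (hh : ∀ e, ‖h e‖ ≤ D) :
    G.Sections →L[ℂ] G.Sections :=
  (Sections.mulByₗ h D hD hh).mkContinuous D (Sections.norm_mulByₗ_le h D hD hh)

variable (G)

/-- The continuous compactly supported functions on the edges, as sections. -/
def ccSections : Submodule ℂ G.Sections where
  carrier := {w : G.Sections | Continuous w.ev ∧ HasCompactSupport w.ev}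
  add_mem' hw hw' := ⟨hw.1.add hw'.1, hw.2.add hw'.2⟩
  zero_mem' := ⟨continuous_const, HasCompactSupport.zero⟩
  smul_mem' c _ hw := ⟨hw.1.const_smul c, hw.2.smul_left (f := fun _ => c)⟩

/-- The completion of `C_c(E)` in the norm `sup_v (∑_{s(e) = v} |ξ(e)|²)^{1/2}`. -/
def Corr : Type _ := G.ccSections.topologicalClosure

instance : NormedAddCommGroup G.Corr :=
  inferInstanceAs (NormedAddCommGroup G.ccSections.topologicalClosure)

instance : NormedSpace ℂ G.Corr :=
  inferInstanceAs (NormedSpace ℂ G.ccSections.topologicalClosure)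

instance : CompleteSpace G.Corr :=
  inferInstanceAs (CompleteSpace G.ccSections.topologicalClosure)

variable {G}

/-- The value of an element of the completion at an edge. -/
def Corr.ev (ξ : G.Corr) : E → ℂ := Sections.ev ξ.1

theorem Corr.ext_ev {ξ η : G.Corr} (h : ∀ e, ξ.ev e = η.ev e) : ξ = η :=
  Subtype.ext (Sections.ext_ev h)

theorem Corr.ev_add (ξ η : G.Corr) (e : E) : (ξ + η).ev e = ξ.ev e + η.ev e := rfl

theorem Corr.ev_smul (c : ℂ) (ξ : G.Corr) (e : E) : (c • ξ).ev e = c * ξ.ev e := rfl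

theorem mulBy_mem {h : E → ℂ} (hc : Continuous h) (D : ℝ) (hD : 0 ≤ D) (hh : ∀ e, ‖h e‖ ≤ D)
    {w : G.Sections} (hw : w ∈ G.ccSections.topologicalClosure) :
    Sections.mulBy h D hD hh w ∈ G.ccSections.topologicalClosure :=
  map_mem_closure (Sections.mulBy h D hD hh).continuous hw fun _ hw' =>
    ⟨hc.mul hw'.1, hw'.2.mul_left⟩

/-- Multiplication by a bounded continuous function on the edges, on the completion. -/
def Corr.mulBy (h : E → ℂ) (hc : Continuous h) (D : ℝ) (hD : 0 ≤ D) (hh : ∀ e, ‖h e‖ ≤ D) :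
    G.Corr →L[ℂ] G.Corr :=
  ((Sections.mulBy h D hD hh).comp G.ccSections.topologicalClosure.subtypeL).codRestrict
    G.ccSections.topologicalClosure fun ξ => mulBy_mem hc D hD hh ξ.2

theorem Corr.ev_mulBy (h : E → ℂ) (hc : Continuous h) (D : ℝ) (hD : 0 ≤ D) (hh : ∀ e, ‖h e‖ ≤ D)
    (ξ : G.Corr) (e : E) : (Corr.mulBy h hc D hD hh ξ).ev e = h e * ξ.ev e := rfl

theorem inner_apply (w w' : G.Sections) (v : V) :
    inner ℂ (w v) (w' v) = ∑' e : {e // G.s e = v}, star (w.ev e) * w'.ev e := by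
  rw [lp.inner_eq_tsum]
  refine tsum_congr fun e => ?_
  rw [w.apply_eq, w'.apply_eq, RCLike.inner_apply, mul_comm]
  rfl

theorem norm_coe_le (g : C₀(V, ℂ)) (v : V) : ‖g v‖ ≤ ‖g‖ := g.toBCF.norm_coe_le_norm v

section Inner

variable [T2Space V] [T2Space E]

theorem exists_inner_of_mem_cc {w w' : G.Sections} (hw : w ∈ G.ccSections)
    (hw' : w' ∈ G.ccSections) : ∃ g : C₀(V, ℂ), ∀ v, g v = inner ℂ (w v) (w' v) := by
  have hcont : Continuous fun e => star (w.ev e) * w'.ev e := hw.1.star.mul hw'.1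
  have hcs : HasCompactSupport fun e => star (w.ev e) * w'.ev e := hw'.2.mul_left
  have hs := G.isLocalHomeomorph_s
  have hc := continuous_tsum_fibre hs hcont hcs
  refine ⟨⟨⟨_, hc⟩, ?_⟩, fun v => (inner_apply w w' v).symm⟩
  have : HasCompactSupport
      fun v => ∑' e : {e // G.s e = v}, star (w.ev e) * w'.ev e :=
    HasCompactSupport.intro (hcs.isCompact.image hs.continuous) fun v hv =>
      tsum_fibre_eq_zero hv
  exact this.is_zero_at_infty

theorem exists_inner {w w' : G.Sections} (hw : w ∈ G.ccSections.topologicalClosure)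
    (hw' : w' ∈ G.ccSections.topologicalClosure) :
    ∃ g : C₀(V, ℂ), ∀ v, g v = inner ℂ (w v) (w' v) := by
  have key : ∀ ε > 0, ∃ g : C₀(V, ℂ), ∀ v, dist (inner ℂ (w v) (w' v)) (g v) < ε := by
    intro ε hε
    set M := ‖w‖ + ‖w'‖ + 2 with hM
    have hM0 : 0 < M := by positivity
    obtain ⟨u, hu, hwu⟩ := Metric.mem_closure_iff.1 hw (min 1 (ε / M)) (by positivity)
    obtain ⟨u', hu', hwu'⟩ := Metric.mem_closure_iff.1 hw' (ε / M) (by positivity)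
    obtain ⟨g, hg⟩ := exists_inner_of_mem_cc hu hu'
    refine ⟨g, fun v => ?_⟩
    rw [dist_eq_norm] at hwu hwu'
    have h1 : ‖w v - u v‖ ≤ ‖w - u‖ := lp.norm_apply_le_norm (by simp) (w - u) v
    have h2 : ‖w' v - u' v‖ ≤ ‖w' - u'‖ := lp.norm_apply_le_norm (by simp) (w' - u') v
    have h3 : ‖w' v‖ ≤ ‖w'‖ := lp.norm_apply_le_norm (by simp) w' v
    have h4 : ‖u v‖ ≤ ‖w‖ + 1 := by
      have h5 : ‖u‖ ≤ ‖w‖ + ‖w - u‖ := by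
        have := norm_sub_le w (w - u)
        rwa [sub_sub_cancel] at this
      have h6 : ‖u v‖ ≤ ‖u‖ := lp.norm_apply_le_norm (by simp) u v
      have h7 := hwu.trans_le (min_le_left _ _)
      linarith
    have h8 := hwu.trans_le (min_le_right _ _)
    rw [hg, dist_eq_norm]
    have e : inner ℂ (w v) (w' v) - inner ℂ (u v) (u' v) =
        inner ℂ (w v - u v) (w' v) + inner ℂ (u v) (w' v - u' v) := by
      rw [inner_sub_left, inner_sub_right]; ring
    rw [e]
    calc _ ≤ ‖w v - u v‖ * ‖w' v‖ + ‖u v‖ * ‖w' v - u' v‖ :=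
          (norm_add_le _ _).trans (add_le_add (norm_inner_le_norm _ _) (norm_inner_le_norm _ _))
      _ ≤ (ε / M) * ‖w'‖ + (‖w‖ + 1) * (ε / M) := by
          gcongr
          · exact h1.trans h8.le
          · exact h2.trans hwu'.le
      _ < (ε / M) * M := by rw [hM]; nlinarith [div_pos hε hM0]
      _ = ε := div_mul_cancel₀ _ hM0.ne'
  have hcont : Continuous fun v => inner ℂ (w v) (w' v) := by
    refine continuous_of_uniform_approx_of_continuous fun U hU => ?_
    obtain ⟨ε, hε, hεU⟩ := Metric.mem_uniformity_dist.1 hU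
    obtain ⟨g, hg⟩ := key ε hε
    exact ⟨g, g.continuous, fun v => hεU (hg v)⟩
  refine ⟨⟨⟨_, hcont⟩, ?_⟩, fun v => rfl⟩
  rw [Metric.tendsto_nhds]
  intro ε hε
  obtain ⟨g, hg⟩ := key (ε / 2) (by positivity)
  filter_upwards [Metric.tendsto_nhds.1 (zero_at_infty g) (ε / 2) (by positivity)] with v hv
  calc _ ≤ _ := dist_triangle _ (g v) _
    _ < ε / 2 + ε / 2 := add_lt_add (hg v) hv
    _ = ε := add_halves ε

theorem exists_fibreBound {f : E → ℂ} (hf : Continuous f) (hc : HasCompactSupport f) :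
    ∃ C, 0 ≤ C ∧ G.FibreBound f C := by
  have hcont : Continuous fun e => star (f e) * f e := hf.star.mul hf
  have hcs : HasCompactSupport fun e => star (f e) * f e := hc.mul_left
  have hs := G.isLocalHomeomorph_s
  have hΦ := continuous_tsum_fibre hs hcont hcs
  have hΦc : HasCompactSupport fun v => ∑' e : {e // G.s e = v}, star (f e) * f e :=
    HasCompactSupport.intro (hcs.isCompact.image hs.continuous) fun v hv =>
      tsum_fibre_eq_zero hv
  obtain ⟨C, hC⟩ := hΦc.exists_bound_of_continuous hΦ
  refine ⟨Real.sqrt C, Real.sqrt_nonneg _, fun v F hF => ?_⟩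
  have hC0 : 0 ≤ C := (norm_nonneg _).trans (hC v)
  rw [Real.sq_sqrt hC0]
  refine le_trans ?_ (hC v)
  have hfin : Set.Finite {e : {e // G.s e = v} | e.1 ∈ tsupport f} := by
    refine Set.Finite.preimage Subtype.val_injective.injOn
      ((finite_fibre hs hc.isCompact v).subset ?_) |>.subset
      (s := Subtype.val ⁻¹' {e | e ∈ tsupport f ∧ G.s e = v}) ?_
    · exact fun _ h => h
    · exact fun e he => ⟨he, e.2⟩
  have hreal : ∀ e, star (f e) * f e = ((‖f e‖ ^ 2 : ℝ) : ℂ) := fun e => by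
    rw [Complex.star_def, Complex.conj_mul']; simp
  simp only [hreal]
  rw [← Complex.ofReal_tsum, Complex.norm_real]
  refine le_trans ?_ (Real.le_norm_self _)
  have hsum : Summable fun e : {e // G.s e = v} => ‖f e‖ ^ 2 :=
    summable_of_hasFiniteSupport (hfin.subset fun e he => by
      refine subset_tsupport _ ?_
      intro h0
      exact he (by simp [h0]))
  classical
  have h2 : ∑ e ∈ F.subtype (fun e => G.s e = v), ‖f e‖ ^ 2 = ∑ e ∈ F, ‖f e‖ ^ 2 := by
    rw [Finset.sum_subtype_eq_sum_filter (f := fun e => ‖f e‖ ^ 2),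
      Finset.filter_true_of_mem hF]
  rw [← h2]
  exact hsum.sum_le_tsum _ fun _ _ => by positivity

/-- The `C_0(V)`-valued inner product on the completion. -/
def Corr.innerC (ξ η : G.Corr) : C₀(V, ℂ) := (exists_inner ξ.2 η.2).choose

theorem Corr.innerC_eq (ξ η : G.Corr) (v : V) : Corr.innerC ξ η v = inner ℂ (ξ.1 v) (η.1 v) :=
  (exists_inner ξ.2 η.2).choose_spec v

/-- The inner product is `⟨ξ, η⟩(v) = ∑_{s(e) = v} conj ξ(e) η(e)`. -/
theorem Corr.innerC_apply (ξ η : G.Corr) (v : V) :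
    Corr.innerC ξ η v = ∑' e : {e // G.s e = v}, star (ξ.ev e) * η.ev e :=
  (Corr.innerC_eq ξ η v).trans (inner_apply _ _ v)

/-- The topological graph correspondence over `C_0(V)` of a topological graph, with actions
`(f · ξ · g)(e) = f(r(e)) ξ(e) g(s(e))`. -/
instance : Correspondence C₀(V, ℂ) G.Corr where
  inner := Corr.innerC
  right ξ g := Corr.mulBy (fun e => g (G.s e))
    (g.continuous.comp G.isLocalHomeomorph_s.continuous) ‖g‖ (norm_nonneg _)
    (fun e => norm_coe_le g _) ξ
  left :=
    { toFun := fun f => Corr.mulBy (fun e => f (G.r e)) (f.continuous.comp G.continuous_r) ‖f‖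
        (norm_nonneg _) (fun e => norm_coe_le f _)
      map_smul' := fun c f => ContinuousLinearMap.ext fun ξ => Corr.ext_ev fun e => by
        change (c • f (G.r e)) * ξ.ev e = c * (f (G.r e) * ξ.ev e)
        rw [smul_eq_mul, mul_assoc]
      map_zero' := ContinuousLinearMap.ext fun ξ => Corr.ext_ev fun e => zero_mul (ξ.ev e)
      map_add' := fun f g => ContinuousLinearMap.ext fun ξ => Corr.ext_ev fun e =>
        add_mul (f (G.r e)) (g (G.r e)) (ξ.ev e)
      map_mul' := fun f g => ContinuousLinearMap.ext fun ξ => Corr.ext_ev fun e =>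
        mul_assoc (f (G.r e)) (g (G.r e)) (ξ.ev e) }
  inner_add_right ξ η ζ := by
    ext v
    rw [ZeroAtInftyContinuousMap.add_apply]
    simp only [Corr.innerC_eq]
    exact inner_add_right _ _ _
  inner_smul_right c ξ η := by
    ext v
    rw [ZeroAtInftyContinuousMap.smul_apply]
    simp only [Corr.innerC_eq]
    exact inner_smul_right _ _ _
  inner_right ξ η g := by
    ext v
    rw [ZeroAtInftyContinuousMap.mul_apply]
    simp only [Corr.innerC_apply]
    rw [← tsum_mul_right]
    refine tsum_congr fun e => ?_
    change star (ξ.ev e) * (g (G.s e) * η.ev e) = _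
    rw [e.2]
    ring
  star_inner ξ η := by
    ext v
    rw [ZeroAtInftyContinuousMap.star_apply]
    simp only [Corr.innerC_eq]
    exact inner_conj_symm _ _
  inner_self_nonneg ξ := by
    let b : C₀(V, ℂ) :=
      ⟨⟨fun v => (Real.sqrt ‖Corr.innerC ξ ξ v‖ : ℂ), by fun_prop⟩, by
        have h := zero_at_infty (Corr.innerC ξ ξ)
        have hc : Continuous fun z : ℂ => (Real.sqrt ‖z‖ : ℂ) := by fun_prop
        have := (hc.tendsto 0).comp h
        simp only [norm_zero, Real.sqrt_zero, Complex.ofReal_zero] at this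
        exact this⟩
    refine ⟨b, ?_⟩
    ext v
    rw [ZeroAtInftyContinuousMap.mul_apply, ZeroAtInftyContinuousMap.star_apply]
    change _ = star (Real.sqrt ‖Corr.innerC ξ ξ v‖ : ℂ) * (Real.sqrt ‖Corr.innerC ξ ξ v‖ : ℂ)
    rw [Complex.star_def, Complex.conj_ofReal, ← Complex.ofReal_mul,
      Real.mul_self_sqrt (norm_nonneg _), Corr.innerC_eq, inner_self_eq_norm_sq_to_K]
    simp
  norm_sq ξ := by
    have hv : ∀ v, ‖Corr.innerC ξ ξ v‖ = ‖ξ.1 v‖ ^ 2 := fun v => by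
      rw [Corr.innerC_eq, inner_self_eq_norm_sq_to_K]; simp
    apply le_antisymm
    · have h1 : ‖ξ.1‖ ≤ Real.sqrt ‖Corr.innerC ξ ξ‖ := by
        refine lp.norm_le_of_forall_le (Real.sqrt_nonneg _) fun v => ?_
        refine Real.le_sqrt_of_sq_le ?_
        rw [← hv]
        exact norm_coe_le _ v
      have h2 : ‖ξ‖ = ‖ξ.1‖ := rfl
      rw [h2]
      calc _ ≤ Real.sqrt ‖Corr.innerC ξ ξ‖ ^ 2 := by gcongr
        _ = _ := Real.sq_sqrt (norm_nonneg _)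
    · refine (BoundedContinuousFunction.norm_le (by positivity)).2 fun v => ?_
      refine (hv v).le.trans ?_
      have h2 : ‖ξ.1 v‖ ≤ ‖ξ.1‖ := lp.norm_apply_le_norm (by simp) ξ.1 v
      exact pow_le_pow_left₀ (norm_nonneg _) h2 2
  inner_left f ξ η := by
    ext v
    simp only [Corr.innerC_apply]
    refine tsum_congr fun e => ?_
    change star (f (G.r e) * ξ.ev e) * η.ev e = star (ξ.ev e) * (star (f (G.r e)) * η.ev e)
    rw [star_mul, mul_assoc]

end Inner

end TopologicalGraph

/-- A topological `k`-graph: a small category with locally compact Hausdorff spaces of objects and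
morphisms, continuous range map `r`, source map `s` a local homeomorphism, continuous open
composition, and a continuous degree functor `d` to `ℕ^k` with the factorization property.  The
composite `comp l m` is defined when `s l = r m`.  No countability of the topology is required. -/
structure TopologicalKGraph.{u} (k : ℕ) where
  Obj : Type u
  Mor : Type u
  [topObj : TopologicalSpace Obj]
  [topMor : TopologicalSpace Mor]
  [t2Obj : T2Space Obj]
  [t2Mor : T2Space Mor]
  [lcObj : LocallyCompactSpace Obj]
  [lcMor : LocallyCompactSpace Mor]
  r : Mor → Obj
  s : Mor → Obj
  ident : Obj → Mor
  comp : ∀ l m : Mor, s l = r m → Mor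
  r_ident : ∀ v, r (ident v) = v
  s_ident : ∀ v, s (ident v) = v
  r_comp : ∀ l m h, r (comp l m h) = r l
  s_comp : ∀ l m h, s (comp l m h) = s m
  ident_comp : ∀ l h, comp (ident (r l)) l h = l
  comp_ident : ∀ l h, comp l (ident (s l)) h = l
  comp_assoc : ∀ l m n h₁ h₂ h₃ h₄, comp (comp l m h₁) n h₂ = comp l (comp m n h₃) h₄
  continuous_r : Continuous r
  isLocalHomeomorph_s : IsLocalHomeomorph s
  continuous_comp : Continuous fun z : {z : Mor × Mor // s z.1 = r z.2} => comp z.1.1 z.1.2 z.2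
  isOpenMap_comp : IsOpenMap fun z : {z : Mor × Mor // s z.1 = r z.2} => comp z.1.1 z.1.2 z.2
  d : Mor → Fin k → ℕ
  continuous_d : Continuous d
  d_ident : ∀ v, d (ident v) = 0
  d_comp : ∀ l m h, d (comp l m h) = d l + d m
  factorization : ∀ l m n, d l = m + n →
    ∃! z : {z : Mor × Mor // s z.1 = r z.2}, d z.1.1 = m ∧ d z.1.2 = n ∧ comp z.1.1 z.1.2 z.2 = l

namespace TopologicalKGraph

attribute [instance] topObj topMor t2Obj t2Mor lcObj lcMor

variable {k : ℕ} (L : TopologicalKGraph k)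

/-- The space `Λ^m` of paths of degree `m`. -/
abbrev Path (m : Fin k → ℕ) : Type _ := {l : L.Mor // L.d l = m}

/-- The topological graph `E_m = (Λ^0, Λ^m, r|, s|)`. -/
def graph (m : Fin k → ℕ) : TopologicalGraph L.Obj (L.Path m) where
  r l := L.r l.1
  s l := L.s l.1
  continuous_r := L.continuous_r.comp continuous_subtype_val
  isLocalHomeomorph_s := L.isLocalHomeomorph_s.comp
    ((isOpen_discrete {m}).preimage L.continuous_d).isOpenEmbedding_subtypeVal.isLocalHomeomorph

end TopologicalKGraph

/-- A topological dynamical system: a locally compact Hausdorff space `Ω` with `k` pairwise commuting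
local homeomorphisms `T 0, …, T (k - 1)`. -/
structure TDS.{u} (k : ℕ) (Ω : Type u) [TopologicalSpace Ω] where
  T : Fin k → Ω → Ω
  isLocalHomeomorph_T : ∀ i, IsLocalHomeomorph (T i)
  commute : ∀ i j, Function.Commute (T i) (T j)

namespace TDS

universe u

variable {k : ℕ} {Ω : Type u} [TopologicalSpace Ω] (D : TDS k Ω)

/-- The composite of the maps `T_i^{m_i}` for `i` in the list. -/
def thetaList (m : Fin k → ℕ) : List (Fin k) → Ω → Ω
  | [] => id
  | i :: l => (D.T i)^[m i] ∘ thetaList m l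

/-- `Θ_m = T_1^{m_1} ⋯ T_k^{m_k}`. -/
def Theta (m : Fin k → ℕ) : Ω → Ω := D.thetaList m (List.finRange k)

theorem commute_thetaList (n : Fin k → ℕ) (i : Fin k) (j : ℕ) (l : List (Fin k)) :
    Function.Commute (D.T i)^[j] (D.thetaList n l) := by
  induction l with
  | nil => exact Function.Commute.id_right
  | cons a l ih => exact ((D.commute i a).iterate_iterate j (n a)).comp_right ih

theorem Theta_add (m n : Fin k → ℕ) (x : Ω) : D.Theta (m + n) x = D.Theta n (D.Theta m x) := by
  suffices h : ∀ l, D.thetaList (m + n) l = D.thetaList n l ∘ D.thetaList m l from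
    congrFun (h _) x
  intro l
  induction l with
  | nil => rfl
  | cons a l ih =>
    funext y
    simp only [thetaList, Function.comp_apply, ih, Pi.add_apply]
    rw [Nat.add_comm (m a), Function.iterate_add_apply]
    congr 1
    exact D.commute_thetaList n a (m a) l _

theorem Theta_zero (x : Ω) : D.Theta 0 x = x := by
  suffices h : ∀ l, D.thetaList 0 l = id from congrFun (h _) x
  intro l
  induction l with
  | nil => rfl
  | cons a l ih => simp [thetaList, ih]

theorem isLocalHomeomorph_Theta (m : Fin k → ℕ) : IsLocalHomeomorph (D.Theta m) := by
  have hit : ∀ i (j : ℕ), IsLocalHomeomorph (D.T i)^[j] := by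
    intro i j
    induction j with
    | zero => exact (Homeomorph.refl Ω).isLocalHomeomorph
    | succ j ih => exact ih.comp (D.isLocalHomeomorph_T i)
  suffices h : ∀ l, IsLocalHomeomorph (D.thetaList m l) from h _
  intro l
  induction l with
  | nil => exact (Homeomorph.refl Ω).isLocalHomeomorph
  | cons a l ih => exact (hit _ _).comp ih

theorem isLocalHomeomorph_s :
    IsLocalHomeomorph fun l : (Fin k → ℕ) × Ω => D.Theta l.1 l.2 := by
  refine IsLocalHomeomorph.mk _ fun l => ?_
  obtain ⟨n, x⟩ := l
  have : Nonempty Ω := ⟨x⟩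
  obtain ⟨φ, hx, hφ⟩ := D.isLocalHomeomorph_Theta n x
  have ho : Topology.IsOpenEmbedding fun y : Ω => (n, y) := by
    refine .of_continuous_injective_isOpenMap (by fun_prop) (fun y z h => congrArg Prod.snd h) ?_
    intro U hU
    have : (fun y : Ω => (n, y)) '' U = {n} ×ˢ U := by
      ext ⟨a, b⟩
      simp [eq_comm, and_comm]
    rw [this]
    exact (isOpen_discrete _).prod hU
  let e := ho.toOpenPartialHomeomorph
  have he : ∀ y, e.symm (n, y) = y := fun y => e.left_inv (Set.mem_univ y)
  refine ⟨e.symm.trans φ, ?_, ?_⟩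
  · rw [OpenPartialHomeomorph.trans_source]
    refine ⟨⟨x, trivial, rfl⟩, ?_⟩
    change e.symm (n, x) ∈ φ.source
    rwa [he]
  · rintro ⟨a, b⟩ hl
    rw [OpenPartialHomeomorph.trans_source] at hl
    have h1 : (a, b) ∈ Set.range fun y : Ω => (n, y) := by
      have := hl.1
      simpa [e] using this
    obtain ⟨y, hy⟩ := h1
    rw [← hy]
    change D.Theta n y = φ (e.symm (n, y))
    rw [he, hφ]

variable [T2Space Ω] [LocallyCompactSpace Ω]

/-- The topological `k`-graph of a topological dynamical system: objects `Ω`, morphisms `ℕ^k × Ω`,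
`r(n, x) = x`, `s(n, x) = Θ_n(x)`, `(n, x)(m, Θ_n(x)) = (n + m, x)`, `d(n, x) = n`. -/
def kGraph : TopologicalKGraph.{u} k where
  Obj := Ω
  Mor := (Fin k → ℕ) × Ω
  r l := l.2
  s l := D.Theta l.1 l.2
  ident x := (0, x)
  comp l m _ := (l.1 + m.1, l.2)
  r_ident _ := rfl
  s_ident x := D.Theta_zero x
  r_comp _ _ _ := rfl
  s_comp l m h := by rw [D.Theta_add, h]
  ident_comp l _ := by simp
  comp_ident l _ := by simp
  comp_assoc l m n _ _ _ _ := by simp [add_assoc]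
  continuous_r := continuous_snd
  isLocalHomeomorph_s := D.isLocalHomeomorph_s
  continuous_comp := by fun_prop
  isOpenMap_comp := by
    intro W hW
    rw [isOpen_iff_mem_nhds]
    rintro _ ⟨⟨⟨⟨m, x⟩, ⟨n, y⟩⟩, hz⟩, hzW, rfl⟩
    have hxy : D.Theta m x = y := hz
    subst hxy
    let σ : Ω → {z : ((Fin k → ℕ) × Ω) × ((Fin k → ℕ) × Ω) // D.Theta z.1.1 z.1.2 = z.2.2} :=
      fun x => ⟨((m, x), (n, D.Theta m x)), rfl⟩
    have hσ : Continuous σ := by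
      have := (D.isLocalHomeomorph_Theta m).continuous
      fun_prop
    have h1 : ({m + n} : Set (Fin k → ℕ)) ×ˢ (σ ⁻¹' W) ∈ nhds (m + n, x) :=
      ((isOpen_discrete _).prod (hW.preimage hσ)).mem_nhds ⟨rfl, hzW⟩
    refine Filter.mem_of_superset h1 ?_
    rintro ⟨a, b⟩ ⟨rfl, hb⟩
    exact ⟨σ b, hb, rfl⟩
  d l := l.1
  continuous_d := continuous_fst
  d_ident _ := rfl
  d_comp _ _ _ := rfl
  factorization l m n h := by
    refine ⟨⟨((m, l.2), (n, D.Theta m l.2)), rfl⟩, ⟨rfl, rfl, Prod.ext h.symm rfl⟩, ?_⟩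
    rintro ⟨⟨⟨m', x⟩, ⟨n', y⟩⟩, hz⟩ ⟨rfl, rfl, rfl⟩
    refine Subtype.ext (Prod.ext rfl (Prod.ext rfl ?_))
    exact hz.symm

/-- The path `(m, x)` of degree `m`. -/
def pt (m : Fin k → ℕ) (x : Ω) : D.kGraph.Path m := ⟨(m, x), rfl⟩

/-- The space of paths of degree `m` is homeomorphic to `Ω`. -/
def pathHomeo (m : Fin k → ℕ) : D.kGraph.Path m ≃ₜ Ω where
  toFun l := l.1.2
  invFun := D.pt m
  left_inv l := Subtype.ext (Prod.ext l.2.symm rfl)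
  right_inv _ := rfl
  continuous_toFun := continuous_snd.comp continuous_subtype_val
  continuous_invFun := (Continuous.prodMk continuous_const continuous_id).subtype_mk _

theorem forall_path {m : Fin k → ℕ} {P : D.kGraph.Path m → Prop} (h : ∀ x, P (D.pt m x)) (l) :
    P l := (D.pathHomeo m).left_inv l ▸ h _

theorem exists_pt {m : Fin k → ℕ} (l : D.kGraph.Path m) : ∃ x, D.pt m x = l :=
  ⟨_, (D.pathHomeo m).left_inv l⟩

instance (m : Fin k → ℕ) : Correspondence C₀(Ω, ℂ) (D.kGraph.graph m).Corr :=
  inferInstanceAs (Correspondence C₀(D.kGraph.Obj, ℂ) (D.kGraph.graph m).Corr)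

open TopologicalGraph

/-- `(ξη)(m + n, x) = ξ(m, x) η(n, Θ_m(x))` -/
def mulFun (m n p : Fin k → ℕ) (f : D.kGraph.Path m → ℂ) (g : D.kGraph.Path n → ℂ) :
    D.kGraph.Path p → ℂ :=
  fun l => f (D.pt m l.1.2) * g (D.pt n (D.Theta m l.1.2))

variable {D}

theorem fibreBound_mulFun {m n p : Fin k → ℕ} (h : m + n = p) {f : D.kGraph.Path m → ℂ}
    {g : D.kGraph.Path n → ℂ} {B C : ℝ} (hf : (D.kGraph.graph m).FibreBound f B)
    (hg : (D.kGraph.graph n).FibreBound g C) :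
    (D.kGraph.graph p).FibreBound (D.mulFun m n p f g) (B * C) := by
  classical
  subst h
  intro v F hF
  let a : D.kGraph.Path (m + n) → D.kGraph.Path m := fun l => D.pt m l.1.2
  let b : D.kGraph.Path (m + n) → D.kGraph.Path n := fun l => D.pt n (D.Theta m l.1.2)
  have ha : Function.Injective a := fun l l' hl => by
    have : l.1.2 = l'.1.2 := congrArg (fun l => l.1.2) hl
    exact (D.pathHomeo (m + n)).injective this
  rw [← Finset.sum_fiberwise_of_maps_to (t := F.image b) (g := b)
    fun l hl => Finset.mem_image_of_mem b hl]
  calc _ ≤ ∑ y ∈ F.image b, B ^ 2 * ‖g y‖ ^ 2 := by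
        refine Finset.sum_le_sum fun y _ => ?_
        have h1 := hf y.1.2 ((F.filter fun l => b l = y).image a) (by
          intro e he
          obtain ⟨l, hl, rfl⟩ := Finset.mem_image.1 he
          rw [← (Finset.mem_filter.1 hl).2]
          rfl)
        rw [Finset.sum_image ha.injOn] at h1
        refine le_trans (le_of_eq ?_) (mul_le_mul_of_nonneg_right h1 (sq_nonneg _))
        rw [Finset.sum_mul]
        refine Finset.sum_congr rfl fun l hl => ?_
        rw [← (Finset.mem_filter.1 hl).2, ← mul_pow, ← norm_mul]
        rfl
    _ ≤ B ^ 2 * C ^ 2 := by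
        rw [← Finset.mul_sum]
        gcongr
        refine hg v _ fun e he => ?_
        obtain ⟨l, hl, rfl⟩ := Finset.mem_image.1 he
        rw [← hF l hl]
        obtain ⟨x, rfl⟩ := D.exists_pt l
        exact (D.Theta_add m n x).symm
    _ = _ := by ring

/-- The multiplication of sections. -/
def mulSec {m n p : Fin k → ℕ} (h : m + n = p) :
    (D.kGraph.graph m).Sections →ₗ[ℂ] (D.kGraph.graph n).Sections →ₗ[ℂ]
      (D.kGraph.graph p).Sections :=
  LinearMap.mk₂ ℂ
    (fun w w' => Sections.mk (D.mulFun m n p w.ev w'.ev) (‖w‖ * ‖w'‖) (by positivity)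
      (fibreBound_mulFun h w.fibreBound w'.fibreBound))
    (fun _ _ _ => Sections.ext_ev fun _ => add_mul _ _ _)
    (fun c w w' => Sections.ext_ev fun e =>
      mul_assoc c (w.ev (D.pt m e.1.2)) (w'.ev (D.pt n (D.Theta m e.1.2))))
    (fun _ _ _ => Sections.ext_ev fun _ => mul_add _ _ _)
    (fun c w w' => Sections.ext_ev fun e =>
      mul_left_comm (w.ev (D.pt m e.1.2)) c (w'.ev (D.pt n (D.Theta m e.1.2))))

theorem norm_mulSec_le {m n p : Fin k → ℕ} (h : m + n = p) (w : (D.kGraph.graph m).Sections)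
    (w' : (D.kGraph.graph n).Sections) : ‖mulSec h w w'‖ ≤ ‖w‖ * ‖w'‖ :=
  Sections.norm_mk_le (D.mulFun m n p w.ev w'.ev) (‖w‖ * ‖w'‖) (by positivity)
    (fibreBound_mulFun h w.fibreBound w'.fibreBound)

theorem mulSec_mem {m n p : Fin k → ℕ} (h : m + n = p) {w : (D.kGraph.graph m).Sections}
    {w' : (D.kGraph.graph n).Sections} (hw : w ∈ (D.kGraph.graph m).ccSections.topologicalClosure)
    (hw' : w' ∈ (D.kGraph.graph n).ccSections.topologicalClosure) :
    mulSec h w w' ∈ (D.kGraph.graph p).ccSections.topologicalClosure := by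
  have hc : Continuous fun z : (D.kGraph.graph m).Sections × (D.kGraph.graph n).Sections =>
      mulSec h z.1 z.2 :=
    ((mulSec h).mkContinuous₂ 1 fun w w' => by
      rw [one_mul]; exact norm_mulSec_le h w w').continuous₂
  refine map_mem_closure₂ (f := fun w w' => mulSec h w w') hc hw hw' fun u hu u' hu' => ?_
  let e : D.kGraph.Path p ≃ₜ D.kGraph.Path m := (D.pathHomeo p).trans (D.pathHomeo m).symm
  have hb : Continuous fun l : D.kGraph.Path p => D.pt n (D.Theta m l.1.2) :=
    (D.pathHomeo n).symm.continuous.comp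
      ((D.isLocalHomeomorph_Theta m).continuous.comp (D.pathHomeo p).continuous)
  exact ⟨(hu.1.comp e.continuous).mul (hu'.1.comp hb), (hu.2.comp_homeomorph e).mul_right⟩

variable (D)

/-- The multiplication `X_m × X_n → X_p`, `m + n = p`. -/
def mulCorr {m n p : Fin k → ℕ} (h : m + n = p) :
    (D.kGraph.graph m).Corr →ₗ[ℂ] (D.kGraph.graph n).Corr →ₗ[ℂ] (D.kGraph.graph p).Corr :=
  LinearMap.mk₂ ℂ (fun ξ η => ⟨mulSec h ξ.1 η.1, mulSec_mem h ξ.2 η.2⟩)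
    (fun ξ ξ' η => Subtype.ext (LinearMap.map_add₂ (mulSec h) ξ.1 ξ'.1 η.1))
    (fun c ξ η => Subtype.ext (LinearMap.map_smul₂ (mulSec h) c ξ.1 η.1))
    (fun ξ η η' => Subtype.ext (map_add (mulSec h ξ.1) η.1 η'.1))
    (fun c ξ η => Subtype.ext (map_smul (mulSec h ξ.1) c η.1))

theorem ev_mulCorr {m n p : Fin k → ℕ} (h : m + n = p) (ξ : (D.kGraph.graph m).Corr)
    (η : (D.kGraph.graph n).Corr) (x : Ω) :
    (D.mulCorr h ξ η).ev (D.pt p x) = ξ.ev (D.pt m x) * η.ev (D.pt n (D.Theta m x)) := rfl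

theorem inner_mulCorr {m n p : Fin k → ℕ} (h : m + n = p) (ξ ξ' : (D.kGraph.graph m).Corr)
    (η η' : (D.kGraph.graph n).Corr) :
    Corr.innerC (D.mulCorr h ξ η) (D.mulCorr h ξ' η') =
      Corr.innerC η (Correspondence.left (A := C₀(Ω, ℂ)) (Corr.innerC ξ ξ') η') := by
  subst h
  ext v
  have hsum : Summable fun l : {l : D.kGraph.Path (m + n) // (D.kGraph.graph (m + n)).s l = v} =>
      star ((D.mulCorr rfl ξ η).ev l) * (D.mulCorr rfl ξ' η').ev l := by
    refine (lp.summable_inner (𝕜 := ℂ) ((D.mulCorr rfl ξ η).1 v)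
      ((D.mulCorr rfl ξ' η').1 v)).congr fun l => ?_
    rw [Sections.apply_eq, Sections.apply_eq, RCLike.inner_apply, mul_comm]
    rfl
  let ε : (Σ y : {y : D.kGraph.Path n // (D.kGraph.graph n).s y = v},
      {l : D.kGraph.Path m // (D.kGraph.graph m).s l = (D.kGraph.graph n).r y}) ≃
      {l : D.kGraph.Path (m + n) // (D.kGraph.graph (m + n)).s l = v} :=
    { toFun := fun z => ⟨D.pt (m + n) z.2.1.1.2, by
        obtain ⟨⟨y, hy⟩, ⟨l, hl⟩⟩ := z
        obtain ⟨y, rfl⟩ := D.exists_pt y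
        obtain ⟨x, rfl⟩ := D.exists_pt l
        change D.Theta m x = y at hl
        change D.Theta n y = v at hy
        change D.Theta (m + n) x = v
        rw [D.Theta_add, hl, hy]⟩
      invFun := fun l => ⟨⟨D.pt n (D.Theta m l.1.1.2), by
          obtain ⟨l, hl⟩ := l
          obtain ⟨x, rfl⟩ := D.exists_pt l
          exact (D.Theta_add m n x).symm.trans hl⟩,
        ⟨D.pt m l.1.1.2, rfl⟩⟩
      left_inv := by
        rintro ⟨⟨y, hy⟩, ⟨l, hl⟩⟩
        obtain ⟨y, rfl⟩ := D.exists_pt y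
        obtain ⟨x, rfl⟩ := D.exists_pt l
        have hl' : D.Theta m x = y := hl
        subst hl'
        rfl
      right_inv := by
        rintro ⟨l, hl⟩
        obtain ⟨x, rfl⟩ := D.exists_pt l
        rfl }
  have hsum' := (ε.summable_iff).2 hsum
  rw [Corr.innerC_apply, Corr.innerC_apply, ← ε.tsum_eq]
  refine (Summable.tsum_sigma hsum').trans (tsum_congr fun y => ?_)
  change _ = star (η.ev y) * (Corr.innerC ξ ξ' ((D.kGraph.graph n).r y) * η'.ev y)
  rw [Corr.innerC_apply, ← tsum_mul_right, ← tsum_mul_left]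
  refine tsum_congr fun l => ?_
  obtain ⟨y, hy⟩ := y
  obtain ⟨l, hl⟩ := l
  obtain ⟨y, rfl⟩ := D.exists_pt y
  obtain ⟨x, rfl⟩ := D.exists_pt l
  have hl' : D.Theta m x = y := hl
  subst hl'
  change star (ξ.ev (D.pt m x) * η.ev (D.pt n (D.Theta m x))) *
    (ξ'.ev (D.pt m x) * η'.ev (D.pt n (D.Theta m x))) = _
  rw [star_mul]
  ring

theorem fibreBound_zero (f : C₀(Ω, ℂ)) :
    (D.kGraph.graph 0).FibreBound (fun l => f l.1.2) ‖f‖ := by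
  intro v F hF
  have h1 : ∀ l ∈ F, l = D.pt 0 v := by
    intro l hl
    rw [← hF l hl]
    obtain ⟨x, rfl⟩ := D.exists_pt l
    exact congrArg (D.pt 0) (D.Theta_zero x).symm
  have h2 : F ⊆ {D.pt 0 v} := fun l hl => Finset.mem_singleton.2 (h1 l hl)
  refine (Finset.sum_le_sum_of_subset_of_nonneg h2 fun _ _ _ => by positivity).trans ?_
  rw [Finset.sum_singleton]
  exact pow_le_pow_left₀ (norm_nonneg _) (norm_coe_le f v) 2

/-- The identification of `C_0(Ω)` with sections for the graph `E_0`. -/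
def unitSec : C₀(Ω, ℂ) →ₗᵢ[ℂ] (D.kGraph.graph 0).Sections where
  toFun f := Sections.mk (fun l => f l.1.2) ‖f‖ (norm_nonneg f) (D.fibreBound_zero f)
  map_add' _ _ := Sections.ext_ev fun _ => rfl
  map_smul' _ _ := Sections.ext_ev fun _ => rfl
  norm_map' f := by
    refine le_antisymm
      (Sections.norm_mk_le (fun l : D.kGraph.Path 0 => f l.1.2) ‖f‖ (norm_nonneg f)
        (D.fibreBound_zero f)) ?_
    refine (BoundedContinuousFunction.norm_le (norm_nonneg _)).2 fun v => ?_
    have h := (Sections.mk (fun l : D.kGraph.Path 0 => f l.1.2) ‖f‖ (norm_nonneg f)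
      (D.fibreBound_zero f)).fibreBound v {D.pt 0 v} (by
        intro e he
        rw [Finset.mem_singleton.1 he]
        exact D.Theta_zero v)
    rw [Finset.sum_singleton] at h
    exact le_of_sq_le_sq h (norm_nonneg _)

theorem range_unitSec : LinearMap.range D.unitSec.toLinearMap =
    (D.kGraph.graph 0).ccSections.topologicalClosure := by
  apply le_antisymm
  · rintro _ ⟨f, rfl⟩
    refine Metric.mem_closure_iff.2 fun ε hε => ?_
    have h0 := Metric.tendsto_nhds.1 (zero_at_infty f) (ε / 2) (by positivity)
    obtain ⟨K, hK, hfK⟩ := Filter.mem_cocompact.1 h0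
    obtain ⟨g, -, hg1, hg2, hg3⟩ : ∃ g : C(Ω, ℝ), True ∧ HasCompactSupport g ∧
        (∀ x ∈ K, g x = 1) ∧ ∀ x, 0 ≤ g x ∧ g x ≤ 1 := by
      obtain ⟨g, h1, -, h3, h4⟩ := exists_continuous_one_zero_of_isCompact hK isClosed_empty
        (Set.disjoint_empty K)
      exact ⟨g, trivial, h3, h1, h4⟩
    have hc : Continuous fun x => f x * (g x : ℂ) :=
      f.continuous.mul (Complex.continuous_ofReal.comp g.continuous)
    have hs : HasCompactSupport fun x => f x * (g x : ℂ) :=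
      (hg1.comp_left (g := Complex.ofReal) Complex.ofReal_zero).mul_left
    let u : C₀(Ω, ℂ) := ⟨⟨_, hc⟩, hs.is_zero_at_infty⟩
    refine ⟨D.unitSec u, ⟨hc.comp (D.pathHomeo 0).continuous,
      hs.comp_homeomorph (D.pathHomeo 0)⟩, ?_⟩
    change dist (D.unitSec f) (D.unitSec u) < ε
    rw [D.unitSec.dist_map, dist_eq_norm]
    refine lt_of_le_of_lt ?_ (half_lt_self hε)
    refine (BoundedContinuousFunction.norm_le (by positivity)).2 fun x => ?_
    change ‖f x - f x * (g x : ℂ)‖ ≤ ε / 2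
    have e : f x - f x * (g x : ℂ) = f x * ((1 - g x : ℝ) : ℂ) := by push_cast; ring
    rw [e, norm_mul, Complex.norm_real]
    by_cases hx : x ∈ K
    · rw [hg2 x hx]; simp; positivity
    · have h1 : dist (f x) 0 < ε / 2 := hfK hx
      rw [dist_zero_right] at h1
      have h2 : ‖1 - g x‖ ≤ 1 := by
        rw [Real.norm_eq_abs, abs_le]
        constructor <;> linarith [(hg3 x).1, (hg3 x).2]
      calc _ ≤ ε / 2 * 1 := by gcongr
        _ = _ := mul_one _
  · refine Submodule.topologicalClosure_minimal _ ?_ ?_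
    · intro w hw
      have hc : Continuous fun x : Ω => Sections.ev w (D.pt 0 x) :=
        hw.1.comp (D.pathHomeo 0).symm.continuous
      have hs : HasCompactSupport fun x : Ω => Sections.ev w (D.pt 0 x) :=
        hw.2.comp_homeomorph (D.pathHomeo 0).symm
      refine ⟨⟨⟨_, hc⟩, hs.is_zero_at_infty⟩, Sections.ext_ev (D.forall_path fun x => rfl)⟩
    · exact D.unitSec.isometry.isClosedEmbedding.isClosed_range

/-- The identification of `C_0(Ω)` with the fibre over `0`. -/
def unitCorr : C₀(Ω, ℂ) ≃ₗ[ℂ] (D.kGraph.graph 0).Corr :=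
  (LinearEquiv.ofInjective D.unitSec.toLinearMap D.unitSec.injective).trans
    (LinearEquiv.ofEq _ _ D.range_unitSec)

theorem ev_unitCorr (f : C₀(Ω, ℂ)) (x : Ω) : (D.unitCorr f).ev (D.pt 0 x) = f x := rfl

theorem dense_mulCorr {m n p : Fin k → ℕ} (h : m + n = p) :
    Submodule.topologicalClosure (Submodule.span ℂ
      {z : (D.kGraph.graph p).Corr | ∃ ξ η, D.mulCorr (m := m) (n := n) h ξ η = z}) = ⊤ := by
  rw [eq_top_iff]
  rintro ζ -
  have hcc : ∀ (w : (D.kGraph.graph p).Sections) (hw : w ∈ (D.kGraph.graph p).ccSections),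
      ∃ ξ η, D.mulCorr (m := m) (n := n) h ξ η =
        ⟨w, Submodule.le_topologicalClosure _ hw⟩ := by
    intro w hw
    have hc : Continuous fun l : D.kGraph.Path m => w.ev (D.pt p l.1.2) :=
      hw.1.comp ((D.pathHomeo p).symm.continuous.comp (D.pathHomeo m).continuous)
    have hs : HasCompactSupport fun l : D.kGraph.Path m => w.ev (D.pt p l.1.2) :=
      hw.2.comp_homeomorph ((D.pathHomeo m).trans (D.pathHomeo p).symm)
    have hK : IsCompact (D.Theta m '' ((D.pathHomeo p) '' tsupport w.ev)) :=
      (hw.2.isCompact.image (D.pathHomeo p).continuous).image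
        (D.isLocalHomeomorph_Theta m).continuous
    obtain ⟨g, hg1, -, hg2, -⟩ := exists_continuous_one_zero_of_isCompact hK isClosed_empty
      (Set.disjoint_empty _)
    have hgc : Continuous fun l : D.kGraph.Path n => (g l.1.2 : ℂ) :=
      Complex.continuous_ofReal.comp (g.continuous.comp (D.pathHomeo n).continuous)
    have hgs : HasCompactSupport fun l : D.kGraph.Path n => (g l.1.2 : ℂ) :=
      (hg2.comp_left (g := Complex.ofReal) Complex.ofReal_zero).comp_homeomorph (D.pathHomeo n)
    obtain ⟨B, hB, hB'⟩ := exists_fibreBound (G := D.kGraph.graph m) hc hs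
    obtain ⟨C, hC, hC'⟩ := exists_fibreBound (G := D.kGraph.graph n) hgc hgs
    refine ⟨⟨Sections.mk _ B hB hB', Submodule.le_topologicalClosure _ ⟨hc, hs⟩⟩,
      ⟨Sections.mk _ C hC hC', Submodule.le_topologicalClosure _ ⟨hgc, hgs⟩⟩,
      Corr.ext_ev (D.forall_path fun x => ?_)⟩
    change w.ev (D.pt p x) * (g (D.Theta m x) : ℂ) = w.ev (D.pt p x)
    by_cases hx : w.ev (D.pt p x) = 0
    · rw [hx, zero_mul]
    · have : g (D.Theta m x) = 1 :=
        hg1 ⟨x, ⟨D.pt p x, subset_tsupport _ hx, rfl⟩, rfl⟩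
      rw [this, Complex.ofReal_one, mul_one]
  refine Metric.mem_closure_iff.2 fun ε hε => ?_
  obtain ⟨w, hw, hd⟩ := Metric.mem_closure_iff.1 ζ.2 ε hε
  obtain ⟨ξ, η, e⟩ := hcc w hw
  exact ⟨⟨w, Submodule.le_topologicalClosure _ hw⟩, Submodule.subset_span ⟨ξ, η, e⟩, hd⟩

/-- The topological `k`-graph correspondence `X^Λ`: the product system over `ℕ^k` of
`C_0(Ω)`-correspondences whose fibre over `m` is the topological graph correspondence of `E_m`, with
multiplication `(ξη)(m + n, x) = ξ(m, x) η(n, Θ_m(x))`. -/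
def productSystem : ProductSystem k C₀(Ω, ℂ) where
  X m := (D.kGraph.graph m).Corr
  normedAddCommGroup _ := inferInstance
  normedSpace _ := inferInstance
  completeSpace _ := inferInstance
  correspondence _ := inferInstanceAs (Correspondence C₀(D.kGraph.Obj, ℂ) _)
  mul h := D.mulCorr h
  unit := D.unitCorr
  mul_assoc h₁ h₂ h₃ h₄ ξ η ζ := by
    subst h₁
    subst h₃
    refine Corr.ext_ev (D.forall_path fun x => ?_)
    simp only [ev_mulCorr, D.Theta_add, mul_assoc]
  inner_unit f g := by
    ext v
    change Corr.innerC (D.unitCorr f) (D.unitCorr g) v = star (f v) * g v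
    refine (Corr.innerC_apply (D.unitCorr f) (D.unitCorr g) (v : D.kGraph.Obj)).trans ?_
    let l : {l : D.kGraph.Path 0 // (D.kGraph.graph 0).s l = v} := ⟨D.pt 0 v, D.Theta_zero v⟩
    rw [tsum_eq_single l]
    · rfl
    · rintro ⟨l', hl'⟩ hne
      obtain ⟨x, rfl⟩ := D.exists_pt l'
      refine absurd (Subtype.ext ?_) hne
      exact congrArg (D.pt 0) ((D.Theta_zero x).symm.trans hl')
  right_unit f g := Corr.ext_ev (D.forall_path fun x => by
    change g (D.Theta 0 x) * f x = f x * g x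
    rw [D.Theta_zero, mul_comm])
  left_unit f g := Corr.ext_ev (D.forall_path fun x => rfl)
  unit_mul f ξ := Corr.ext_ev (D.forall_path fun x => by
    rw [ev_mulCorr, D.Theta_zero]
    rfl)
  mul_unit {m} ξ f := Corr.ext_ev (D.forall_path fun x => by
    rw [ev_mulCorr]
    exact mul_comm (ξ.ev (D.pt m x)) (f (D.Theta m x)))
  inner_mul h ξ ξ' η η' := D.inner_mulCorr h ξ ξ' η η'
  dense_mul h _ _ := D.dense_mulCorr h

end TDS

end

open scoped ENNReal ZeroAtInfty

noncomputable section

open Correspondence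

/-! ### Rank-one and compact operators on a correspondence. -/

namespace Correspondence

variable {A E : Type*} [NonUnitalCStarAlgebra A] [NormedAddCommGroup E]
    [NormedSpace ℂ E] [CompleteSpace E] [Correspondence A E]

/-! For the `k`-graph of a dynamical system, the range map on the paths of degree `m` is the
bijection `(m, x) ↦ x`. So `φ_m(f)` is multiplication by `f` on all of `Ω`, and every `φ_m` is
injective. The source map is a local homeomorphism, so a partition of unity cuts a compactly
supported `f` into pieces supported where `Θ_m` is injective. Each piece acts by a rank-one
operator, hence `f` acts by a finite rank operator on every fibre. These facts, with density and
contractivity of the multiplication, make up `IsRegular`, which is verified in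
`isRegular_productSystem`; everything between concerns an arbitrary regular product system.

Injectivity makes `I_p = 0` for `p ≠ 0`, so `X̃_q` is just `X_q` sitting in its top coordinate
(`tilde_apply_eq_zero`, `exists_tilde`). This gives injectivity of `φ̃_q` and turns the hypothesis
of (CP-SY) into the equation `∑ ι_p^s(T_p) = 0` for large `s`. Injectivity also gives `(ker φ_m)^⊥ =
A`, so (CP-K) applies to every `a` for which `φ_m(a)` is compact.

The main point is `exists_extension`: for `p ≤ q` each compact `S` on `X_p` induces a compact
`ι_p^q(S)` on `X_q`, and `ψ^{(q)}(ι_p^q(S)) = ψ^{(p)}(S)` for every `ψ` satisfying (CP-K). If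
`φ_{q-p}(a) = ∑ c Θ_{u,v}`, then `Θ_{ξa,η}` induces `∑ c Θ_{ξu,ηv}`, whose image is `ψ(ξ)
ψ^{(q-p)}(φ_{q-p}(a)) ψ(η)^* = ψ(ξa) ψ(η)^*`. Such operators span a dense subspace of the compacts,
and inducing is contractive (`norm_le_of_extends`), so limits can be taken.

Compact alignment is then immediate. Moving compacts to a common larger fibre, where `ψ^{(q)}` is
linear and multiplicative, gives (CP-SY) and (N) from (CP-K). Conversely, (CP-SY) for the pair
`-φ_0(a)`, `φ_m(a)` is (CP-K). The two covariance conditions therefore coincide, and so do the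
universal algebras. -/

theorem right_mul (x : E) (a b : A) : right (right x a) b = right x (a * b) :=
  ext_inner (A := A) fun z => by simp only [inner_right, mul_assoc]

theorem norm_theta_le (ξ η : E) : ‖theta A ξ η‖ ≤ ‖ξ‖ * ‖η‖ :=
  LinearMap.mkContinuous_norm_le _ (by positivity) _

theorem theta_apply (ξ η ζ : E) : theta A ξ η ζ = right ξ (inner (A := A) η ζ) := rfl

theorem theta_add_left (ξ ξ' η : E) : theta A (ξ + ξ') η = theta A ξ η + theta A ξ' η := by
  refine ContinuousLinearMap.ext fun ζ => ext_inner (A := A) fun z => ?_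
  simp only [_root_.add_apply, theta_apply, ← star_inner (A := A) _ z,
    inner_add_left, inner_right_left, mul_add, star_add]

theorem theta_smul_left (c : ℂ) (ξ η : E) : theta A (c • ξ) η = c • theta A ξ η := by
  refine ContinuousLinearMap.ext fun ζ => ext_inner (A := A) fun z => ?_
  simp only [_root_.smul_apply, theta_apply, inner_right, inner_smul_right, smul_mul_assoc]

/-- Rank-one operators depend continuously on the first vector. -/
def thetaL (η : E) : E →L[ℂ] (E →L[ℂ] E) :=
  LinearMap.mkContinuous
    { toFun := fun ξ => theta A ξ η
      map_add' := fun ξ ξ' => theta_add_left ξ ξ' η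
      map_smul' := fun c ξ => theta_smul_left c ξ η } ‖η‖
    fun ξ => (norm_theta_le ξ η).trans_eq (mul_comm _ _)


theorem theta_mem_compacts (ξ η : E) : theta A ξ η ∈ compacts A E :=
  Submodule.le_topologicalClosure _ (Submodule.subset_span ⟨(ξ, η), rfl⟩)

theorem compacts_le {N : Submodule ℂ (E →L[ℂ] E)} (hN : IsClosed (N : Set (E →L[ℂ] E)))
    (h : ∀ ξ η, theta A ξ η ∈ N) : compacts A E ≤ N :=
  Submodule.topologicalClosure_minimal _ (Submodule.span_le.2 (by rintro _ ⟨p, rfl⟩; exact h _ _)) hN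

/-- Induction on generalized compact operators for closed linear properties. -/
theorem compacts_induction {p : compacts A E → Prop} (hcl : IsClosed {S | p S})
    (theta : ∀ ξ η : E, p ⟨theta A ξ η, theta_mem_compacts ξ η⟩) (zero : p 0)
    (add : ∀ S T, p S → p T → p (S + T)) (smul : ∀ (c : ℂ) S, p S → p (c • S))
    (S : compacts A E) : p S := by
  let N : Submodule ℂ (compacts A E) :=
    { carrier := {S | p S}
      add_mem' := fun h h' => add _ _ h h'
      zero_mem' := zero
      smul_mem' := fun c _ h => smul c _ h }
  -- The property lives on the subtype, because maps such as `ψ^{(m)}` are continuous only there. A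
  -- closed subset of the compacts is closed among all operators, since the compacts themselves are
  -- closed.
  have hK : IsClosed (compacts A E : Set (E →L[ℂ] E)) := Submodule.isClosed_topologicalClosure _
  have hN : IsClosed ((N.map (compacts A E).subtype : Submodule ℂ (E →L[ℂ] E)) :
      Set (E →L[ℂ] E)) := by
    rw [Submodule.map_coe]
    exact hK.isClosedEmbedding_subtypeVal.isClosedMap _ hcl
  have := compacts_le (A := A) hN fun ξ η => ⟨_, theta ξ η, rfl⟩
  obtain ⟨T, hT, hTS⟩ := this S.2
  have hTS' : T = S := Subtype.ext hTS
  exact hTS' ▸ hT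

/-- A bounded operator on `E` need not commute with the right action. Compact operators do, as
limits of combinations of rank-one operators, and this is why the identity is proved by induction on
`S`. -/
theorem mul_theta {S : E →L[ℂ] E} (hS : S ∈ compacts A E) (ξ η : E) :
    S * theta A ξ η = theta A (S ξ) η := by
  refine compacts_induction (A := A) (p := fun S : compacts A E =>
    (S : E →L[ℂ] E) * theta A ξ η = theta A ((S : E →L[ℂ] E) ξ) η) ?_ ?_ ?_ ?_ ?_ ⟨S, hS⟩
  · refine isClosed_eq (by fun_prop) ?_
    exact (thetaL (A := A) η).continuous.comp
      ((ContinuousLinearMap.apply ℂ E ξ).continuous.comp continuous_subtype_val)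
  · intro ξ' η'
    refine ContinuousLinearMap.ext fun ζ => ?_
    change right ξ' (inner (A := A) η' (right ξ (inner (A := A) η ζ))) =
      right (right ξ' (inner (A := A) η' ξ)) (inner (A := A) η ζ)
    rw [right_mul, inner_right]
  · exact (zero_mul _).trans (map_zero (thetaL (A := A) η)).symm
  · intro S T hS hT
    refine (add_mul _ _ _).trans ?_
    rw [hS, hT]
    exact (theta_add_left _ _ _).symm
  · intro c S hS
    refine (smul_mul_assoc _ _ _).trans ?_
    rw [hS]
    exact (theta_smul_left _ _ _).symm

theorem mul_mem_compacts {S T : E →L[ℂ] E} (hS : S ∈ compacts A E) (hT : T ∈ compacts A E) :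
    S * T ∈ compacts A E := by
  refine compacts_induction (A := A) (p := fun T : compacts A E =>
    S * (T : E →L[ℂ] E) ∈ compacts A E) ?_ ?_ ?_ ?_ ?_ ⟨T, hT⟩
  · exact (Submodule.isClosed_topologicalClosure _).preimage (by fun_prop)
  · intro ξ η
    rw [mul_theta hS]
    exact theta_mem_compacts _ _
  · exact (mul_zero S).symm ▸ zero_mem _
  · intro T T' hT hT'
    exact (mul_add S T.1 T'.1).symm ▸ add_mem hT hT'
  · intro c T hT
    exact (mul_smul_comm c S T.1).symm ▸ Submodule.smul_mem _ c hT

end Correspondence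

/-! ### The homomorphisms `ψ^{(m)}`, compatibility of the actions with multiplication, and the zero
fibre. -/

namespace ProductSystem

universe u v

variable {k : ℕ} {A : Type u} [NonUnitalCStarAlgebra A] {X : ProductSystem k A}

namespace ToeplitzRep

variable {B : Type v} [NonUnitalCStarAlgebra B] (ψ : X.ToeplitzRep B)

/-- The map `ψ^{(m)}` as a continuous linear map on the compact operators. -/
def compactMapL (m : Fin k → ℕ) : X.K m →L[ℂ] B := (ψ.exists_compactMap m).choose

theorem compactMap_of_mem {m} {T : X.X m →L[ℂ] X.X m} (hT : T ∈ X.K m) :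
    ψ.compactMap m T = ψ.compactMapL m ⟨T, hT⟩ := dif_pos hT

theorem compactMap_coe {m} (T : X.K m) : ψ.compactMap m T = ψ.compactMapL m T := dif_pos T.2

theorem compactMap_theta {m} (ξ η : X.X m) :
    ψ.compactMap m (theta A ξ η) = ψ.toFun m ξ * star (ψ.toFun m η) := by
  rw [ψ.compactMap_of_mem (theta_mem_compacts ξ η)]
  exact (ψ.exists_compactMap m).choose_spec ξ η _

theorem compactMap_zero (m) : ψ.compactMap m 0 = 0 := by
  rw [ψ.compactMap_of_mem (zero_mem _)]
  exact map_zero _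

theorem compactMap_add {m} {S T : X.X m →L[ℂ] X.X m} (hS : S ∈ X.K m) (hT : T ∈ X.K m) :
    ψ.compactMap m (S + T) = ψ.compactMap m S + ψ.compactMap m T := by
  rw [ψ.compactMap_of_mem hS, ψ.compactMap_of_mem hT, ψ.compactMap_of_mem (add_mem hS hT)]
  exact map_add (ψ.compactMapL m) ⟨S, hS⟩ ⟨T, hT⟩

theorem compactMap_smul {m} (c : ℂ) {S : X.X m →L[ℂ] X.X m} (hS : S ∈ X.K m) :
    ψ.compactMap m (c • S) = c • ψ.compactMap m S := by
  rw [ψ.compactMap_of_mem hS, ψ.compactMap_of_mem (Submodule.smul_mem _ c hS)]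
  exact map_smul (ψ.compactMapL m) c ⟨S, hS⟩

theorem compactMap_sum {ι : Type*} {m} (F : Finset ι) {S : ι → X.X m →L[ℂ] X.X m}
    (hS : ∀ i ∈ F, S i ∈ X.K m) :
    ψ.compactMap m (∑ i ∈ F, S i) = ∑ i ∈ F, ψ.compactMap m (S i) := by
  classical
  induction F using Finset.induction_on with
  | empty => simp [compactMap_zero]
  | insert a s ha ih =>
    have hs : ∀ i ∈ s, S i ∈ X.K m := fun i hi => hS i (Finset.mem_insert_of_mem hi)
    rw [Finset.sum_insert ha, Finset.sum_insert ha, ψ.compactMap_add (hS a (by simp))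
      (Submodule.sum_mem _ hs), ih hs]

theorem thetaComb_mem {m} (x : X.X m × X.X m →₀ ℂ) : thetaComb m x ∈ X.K m := by
  refine Submodule.le_topologicalClosure _ ?_
  rw [← Finsupp.range_linearCombination]
  exact ⟨x, rfl⟩

theorem compactMap_thetaComb {m} (x : X.X m × X.X m →₀ ℂ) :
    ψ.compactMap m (thetaComb m x) = ψ.repComb m x := by
  induction x using Finsupp.induction_linear with
  | zero => simp [compactMap_zero]
  | add x y hx hy =>
    rw [map_add, map_add, ψ.compactMap_add (thetaComb_mem x) (thetaComb_mem y), hx, hy]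
  | single p c =>
    simp only [thetaComb, repComb, Finsupp.linearCombination_single]
    rw [ψ.compactMap_smul c (theta_mem_compacts _ _), compactMap_theta]

theorem continuous_toFun (m) : Continuous (ψ.toFun m) :=
  AddMonoidHomClass.continuous_of_bound (ψ.toFun m) 1 fun ξ => by
    rw [one_mul]; exact ψ.norm_apply_le ξ

theorem compactMap_mul_toFun {m} {S : X.X m →L[ℂ] X.X m} (hS : S ∈ X.K m) (ζ : X.X m) :
    ψ.compactMap m S * ψ.toFun m ζ = ψ.toFun m (S ζ) := by
  rw [ψ.compactMap_of_mem hS]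
  refine compacts_induction (A := A) (p := fun S : X.K m =>
    ψ.compactMapL m S * ψ.toFun m ζ = ψ.toFun m ((S : X.X m →L[ℂ] X.X m) ζ))
    ?_ ?_ ?_ ?_ ?_ ⟨S, hS⟩
  · refine isClosed_eq ((ψ.compactMapL m).continuous.mul continuous_const) ?_
    exact (ψ.continuous_toFun m).comp
      ((ContinuousLinearMap.apply ℂ (X.X m) ζ).continuous.comp continuous_subtype_val)
  · intro ξ η
    rw [← ψ.compactMap_of_mem, ψ.compactMap_theta, _root_.mul_assoc, ψ.map_inner, ← ψ.map_right]
    rfl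
  · rw [map_zero, zero_mul]
    exact (map_zero _).symm
  · intro S T hS hT
    rw [map_add, add_mul, hS, hT]
    exact (map_add _ _ _).symm
  · intro c S hS
    rw [map_smul, smul_mul_assoc, hS]
    exact (map_smul _ _ _).symm

theorem compactMap_mul {m} {S T : X.X m →L[ℂ] X.X m} (hS : S ∈ X.K m) (hT : T ∈ X.K m) :
    ψ.compactMap m (S * T) = ψ.compactMap m S * ψ.compactMap m T := by
  -- Left multiplication by `S`, restricted to the compacts, so that both sides of the claim are
  -- continuous linear functions of `T`.
  let M : X.K m →L[ℂ] X.K m :=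
    ((ContinuousLinearMap.mul ℂ _ S).comp (X.K m).subtypeL).codRestrict (X.K m)
      fun T => mul_mem_compacts hS T.2
  suffices h : ∀ T : X.K m, ψ.compactMapL m (M T) = ψ.compactMap m S * ψ.compactMapL m T by
    rw [ψ.compactMap_of_mem hT, ψ.compactMap_of_mem (mul_mem_compacts hS hT)]
    exact h ⟨T, hT⟩
  refine compacts_induction (A := A) ?_ ?_ ?_ ?_ ?_
  · exact isClosed_eq (by fun_prop) (continuous_const.mul (ψ.compactMapL m).continuous)
  · intro ξ η
    rw [← ψ.compactMap_of_mem, ← ψ.compactMap_coe, ψ.compactMap_theta]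
    change ψ.compactMap m (S * theta A ξ η) = _
    rw [mul_theta hS, ψ.compactMap_theta, ← ψ.compactMap_mul_toFun hS, _root_.mul_assoc]
  · simp
  · intro T T' h h'
    rw [map_add, map_add, map_add, mul_add, h, h']
  · intro c T h
    rw [map_smul, map_smul, map_smul, mul_smul_comm, h]

end ToeplitzRep

theorem norm_unit (a : A) : ‖X.unit a‖ = ‖a‖ := by
  have h := norm_sq (A := A) (X.unit a)
  rw [X.inner_unit, CStarRing.norm_star_mul_self, ← sq] at h
  exact (sq_eq_sq₀ (norm_nonneg _) (norm_nonneg _)).1 h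

theorem left_mul {m n p : Fin k → ℕ} (h : m + n = p) (a : A) (ξ : X.X m) (η : X.X n) :
    left (A := A) a (X.mul h ξ η) = X.mul h (left (A := A) a ξ) η := by
  rw [← X.unit_mul, ← X.unit_mul]
  exact (X.mul_assoc (zero_add m) h h (zero_add p) _ _ _).symm

theorem right_mul {m n p : Fin k → ℕ} (h : m + n = p) (a : A) (ξ : X.X m) (η : X.X n) :
    right (A := A) (X.mul h ξ η) a = X.mul h ξ (right (A := A) η a) := by
  rw [← X.mul_unit, ← X.mul_unit]
  exact X.mul_assoc h (add_zero p) (add_zero n) h _ _ _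

theorem mul_left {m n p : Fin k → ℕ} (h : m + n = p) (a : A) (ξ : X.X m) (η : X.X n) :
    X.mul h ξ (left (A := A) a η) = X.mul h (right (A := A) ξ a) η := by
  rw [← X.unit_mul, ← X.mul_unit]
  exact (X.mul_assoc (add_zero m) h (zero_add n) h _ _ _).symm

theorem norm_phi_zero (a : A) : ‖X.phi 0 a‖ = ‖a‖ := by
  apply le_antisymm
  · refine ContinuousLinearMap.opNorm_le_bound _ (norm_nonneg a) fun ξ => ?_
    obtain ⟨b, rfl⟩ := X.unit.surjective ξ
    rw [X.left_unit, norm_unit, norm_unit]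
    exact norm_mul_le a b
  -- Testing on `a^*` and using the `C*`-identity gives `‖a‖² ≤ ‖φ_0(a)‖ ‖a‖`; cancelling `‖a‖`
  -- forces the case distinction.
  · have h := (X.phi 0 a).le_opNorm (X.unit (star a))
    rw [X.left_unit, norm_unit, norm_unit, CStarRing.norm_self_mul_star, norm_star] at h
    rcases (norm_nonneg a).eq_or_lt with h0 | h0
    · rw [← h0]; exact norm_nonneg _
    · exact le_of_mul_le_mul_right h h0

/-- The left action on the zero fibre as an isometry. -/
def phiZero (X : ProductSystem k A) : A →ₗᵢ[ℂ] (X.X 0 →L[ℂ] X.X 0) where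
  toFun := X.phi 0
  map_add' := map_add (X.phi 0)
  map_smul' := map_smul (X.phi 0)
  norm_map' := norm_phi_zero

theorem theta_unit (a b : A) : theta A (X.unit a) (X.unit b) = X.phi 0 (a * star b) := by
  refine ContinuousLinearMap.ext fun ξ => ?_
  obtain ⟨c, rfl⟩ := X.unit.surjective ξ
  rw [theta_apply, X.inner_unit, X.right_unit, X.left_unit, _root_.mul_assoc]

/-- Rank-one operators on the zero fibre are left multiplications, and the range of `φ_0` is closed
because `φ_0` is isometric. This supplies the clause for `p = 0` in the definition of induced
operators. -/
theorem exists_phi_zero {S : X.X 0 →L[ℂ] X.X 0} (hS : S ∈ X.K 0) : ∃ a, S = X.phi 0 a := by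
  have hcl : IsClosed (LinearMap.range X.phiZero.toLinearMap : Set (X.X 0 →L[ℂ] X.X 0)) :=
    X.phiZero.isometry.isClosedEmbedding.isClosed_range
  obtain ⟨a, ha⟩ := compacts_le (A := A) hcl (fun ξ η => by
    obtain ⟨a, rfl⟩ := X.unit.surjective ξ
    obtain ⟨b, rfl⟩ := X.unit.surjective η
    rw [theta_unit]
    exact ⟨_, rfl⟩) hS
  exact ⟨a, ha.symm⟩

end ProductSystem


/-! ### Adjoint pairs and a norm estimate from the growth of powers. -/

namespace Correspondence

variable {A E : Type*} [NonUnitalCStarAlgebra A] [NormedAddCommGroup E]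
    [NormedSpace ℂ E] [CompleteSpace E] [Correspondence A E]

/-- The inner product as a continuous linear map in the second variable. -/
def innerL (A : Type*) {E : Type*} [NonUnitalCStarAlgebra A] [NormedAddCommGroup E]
    [NormedSpace ℂ E] [CompleteSpace E] [Correspondence A E] (x : E) : E →L[ℂ] A :=
  LinearMap.mkContinuous
    { toFun := fun y => inner (A := A) x y
      map_add' := inner_add_right x
      map_smul' := fun c y => inner_smul_right c x y } ‖x‖ (norm_inner_le x)

theorem innerL_apply (x y : E) : innerL A x y = inner x y := rfl

theorem norm_theta_sub_le (ξ η ξ' η' : E) :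
    ‖theta A ξ η - theta A ξ' η'‖ ≤ ‖ξ - ξ'‖ * ‖η‖ + ‖ξ'‖ * ‖η - η'‖ := by
  have e : theta A ξ η - theta A ξ' η' = theta A (ξ - ξ') η + theta A ξ' (η - η') := by
    refine ContinuousLinearMap.ext fun ζ => ext_inner (A := A) fun z => ?_
    simp only [← innerL_apply, _root_.add_apply, _root_.sub_apply, map_add, map_sub]
    simp only [innerL_apply, theta_apply, inner_right]
    rw [← star_inner (A := A) ζ (η - η'), ← star_inner (A := A) ζ η, ← star_inner (A := A) ζ η']
    simp only [← innerL_apply, map_sub, star_sub, sub_mul, mul_sub]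
    abel
  rw [e]
  exact (norm_add_le _ _).trans (add_le_add (norm_theta_le _ _) (norm_theta_le _ _))

theorem IsAdjointPair.add {T T' S S' : E →L[ℂ] E} (h : IsAdjointPair A T S)
    (h' : IsAdjointPair A T' S') : IsAdjointPair A (T + T') (S + S') := fun x y => by
  simp only [_root_.add_apply, inner_add_left, inner_add_right, h x y, h' x y]

theorem IsAdjointPair.smul (c : ℂ) {T S : E →L[ℂ] E} (h : IsAdjointPair A T S) :
    IsAdjointPair A (c • T) (star c • S) := fun x y => by
  simp only [_root_.smul_apply, inner_smul_left, inner_smul_right, h x y]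

/-- For a positive operator `G`, exponential growth of `n ↦ G^n z` is a bound for `G z`. -/
theorem norm_apply_le_of_growth {G : E →L[ℂ] E} (hG : IsAdjointPair A G G) (z : E) {C b : ℝ}
    (hb : 0 ≤ b) (h : ∀ n, ‖(G ^ n) z‖ ≤ C * b ^ n) : ‖G z‖ ≤ b * ‖z‖ := by
  have hpow : ∀ n, IsAdjointPair A (G ^ n) (G ^ n) := by
    intro n
    induction n with
    | zero => exact fun x y => rfl
    | succ n ih =>
      intro x y
      rw [pow_succ', mul_apply_eq_comp, hG, ih, ← mul_apply_eq_comp,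
        ← pow_succ, pow_succ']
  have hsq : ∀ n, ‖(G ^ n) z‖ ^ 2 ≤ ‖z‖ * ‖(G ^ (2 * n)) z‖ := by
    intro n
    rw [norm_sq (A := A), hpow, ← mul_apply_eq_comp, ← pow_add, ← two_mul]
    exact norm_inner_le _ _
  -- Iterated Cauchy-Schwarz: each squaring applies `hsq` with `n = 2 ^ j`.
  have hit : ∀ j : ℕ, ‖G z‖ ^ 2 ^ j ≤ ‖z‖ ^ (2 ^ j - 1) * ‖(G ^ 2 ^ j) z‖ := by
    intro j
    induction j with
    | zero => simp
    | succ j ih =>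
      have h1 : 1 ≤ 2 ^ j := Nat.one_le_two_pow
      calc ‖G z‖ ^ 2 ^ (j + 1) = (‖G z‖ ^ 2 ^ j) ^ 2 := by rw [pow_succ, pow_mul]
        _ ≤ (‖z‖ ^ (2 ^ j - 1) * ‖(G ^ 2 ^ j) z‖) ^ 2 := by gcongr
        _ = ‖z‖ ^ (2 * (2 ^ j - 1)) * ‖(G ^ 2 ^ j) z‖ ^ 2 := by rw [mul_pow, ← pow_mul, mul_comm 2]
        _ ≤ ‖z‖ ^ (2 * (2 ^ j - 1)) * (‖z‖ * ‖(G ^ (2 * 2 ^ j)) z‖) := by gcongr; exact hsq _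
        _ = ‖z‖ ^ (2 ^ (j + 1) - 1) * ‖(G ^ 2 ^ (j + 1)) z‖ := by
          rw [← _root_.mul_assoc, ← pow_succ, ← pow_succ' 2 j]
          congr 2
          rw [pow_succ]; omega
  -- Letting `j` grow removes the constant. The extra factor `b` appears because the growth bound
  -- has exponent `2 ^ j` while the criterion uses `2 ^ j - 1`.
  refine le_of_pow_two_pow_le (C := C * b) (by positivity) fun j => ?_
  have h1 : 1 ≤ 2 ^ j := Nat.one_le_two_pow
  calc _ ≤ ‖z‖ ^ (2 ^ j - 1) * (C * b ^ 2 ^ j) := (hit j).trans (by gcongr; exact h _)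
    _ = ‖z‖ ^ (2 ^ j - 1) * (C * (b ^ (2 ^ j - 1) * b)) := by
      rw [← pow_succ, Nat.sub_add_cancel h1]
    _ = _ := by rw [mul_pow]; ring

end Correspondence

/-! ### Regular product systems: uniqueness, adjoints and norms of extended operators. -/

namespace ProductSystem

universe u v

variable {k : ℕ} {A : Type u} [NonUnitalCStarAlgebra A] (X : ProductSystem k A)

open ToeplitzRep

/-- A product system with faithful left actions, nondegenerate and contractive multiplication, and
such that the coefficients acting on all fibres by finite rank operators act nondegenerately. -/
structure IsRegular : Prop where
  dense_mul : ∀ {m n p : Fin k → ℕ} (h : m + n = p),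
    (Submodule.span ℂ {z : X.X p | ∃ x y, X.mul h x y = z}).topologicalClosure = ⊤
  norm_mul_le : ∀ {m n p : Fin k → ℕ} (h : m + n = p) (ξ : X.X m) (η : X.X n),
    ‖X.mul h ξ η‖ ≤ ‖ξ‖ * ‖η‖
  phi_injective : ∀ m, Function.Injective (X.phi m)
  exists_finiteRank : ∀ (m : Fin k → ℕ) (ξ : X.X m), ∀ ε > 0, ∃ (ξ' : X.X m) (a : A),
    (∀ t, ∃ x, X.phi t a = thetaComb t x) ∧ ‖ξ - right ξ' a‖ < ε

variable {X}

/-- `T(ξη) = S(ξ)η` for all `ξ ∈ X_p` and `η ∈ X_{q-p}`. -/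
def Extends {p q : Fin k → ℕ} (S : X.X p →L[ℂ] X.X p) (T : X.X q →L[ℂ] X.X q) : Prop :=
  ∀ (t : Fin k → ℕ) (h : p + t = q) (ξ : X.X p) (η : X.X t),
    T (X.mul h ξ η) = X.mul h (S ξ) η

section Extends

variable {p q : Fin k → ℕ} {S S' : X.X p →L[ℂ] X.X p} {T T' : X.X q →L[ℂ] X.X q}

theorem Extends.add (h : Extends S T) (h' : Extends S' T') : Extends (S + S') (T + T') :=
  fun t e ξ η => by simp [h t e, h' t e]

theorem Extends.smul (c : ℂ) (h : Extends S T) : Extends (c • S) (c • T) :=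
  fun t e ξ η => by simp [h t e]

theorem Extends.zero : Extends (0 : X.X p →L[ℂ] X.X p) (0 : X.X q →L[ℂ] X.X q) :=
  fun t e ξ η => by simp

theorem extends_phi (a : A) : Extends (X.phi p a) (X.phi q a) := fun _ e ξ η => left_mul e a ξ η

end Extends

namespace IsRegular

variable (hX : X.IsRegular)
include hX

variable {p q : Fin k → ℕ} {S S' : X.X p →L[ℂ] X.X p} {T T' : X.X q →L[ℂ] X.X q}

/-- Products span a dense subspace of `X_q`. Regularity asserts this also when a factor has degree
`0`, so `p = 0` and `p = q` need no separate treatment. -/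
theorem ext_of_mul (hpq : p ≤ q) {F : Type*} [NormedAddCommGroup F] [NormedSpace ℂ F]
    {f g : X.X q →L[ℂ] F} (h : ∀ (t : Fin k → ℕ) (e : p + t = q) (ξ : X.X p) (η : X.X t),
      f (X.mul e ξ η) = g (X.mul e ξ η)) : f = g := by
  have e : p + (q - p) = q := add_tsub_cancel_of_le hpq
  refine ContinuousLinearMap.ext_on (s := {z | ∃ x y, X.mul e x y = z}) ?_ ?_
  · exact Submodule.dense_iff_topologicalClosure_eq_top.2 (hX.dense_mul e)
  · rintro _ ⟨x, y, rfl⟩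
    exact h _ e x y

theorem unique (hpq : p ≤ q) (h : Extends S T) (h' : Extends S T') : T = T' :=
  hX.ext_of_mul hpq fun t e ξ η => (h t e ξ η).trans (h' t e ξ η).symm

theorem isAdjointPair (hpq : p ≤ q) (h : Extends S T) (h' : Extends S' T')
    (hS : IsAdjointPair A S S') : IsAdjointPair A T T' := by
  -- Density is used once per variable. With products in both slots, the formula for the inner
  -- product of products moves `S` across as `S'`; here the second slot becomes arbitrary,
  -- afterwards the first.
  have h1 : ∀ (t : Fin k → ℕ) (e : p + t = q) (ξ : X.X p) (η : X.X t) (y : X.X q),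
      inner (A := A) (T (X.mul e ξ η)) y = inner (X.mul e ξ η) (T' y) := by
    intro t e ξ η y
    have : innerL A (T (X.mul e ξ η)) = (innerL A (X.mul e ξ η)).comp T' := by
      refine hX.ext_of_mul hpq fun t' e' ξ' η' => ?_
      obtain rfl : t = t' := add_left_cancel (e.trans e'.symm)
      simp only [ContinuousLinearMap.comp_apply, innerL_apply]
      rw [h, h', X.inner_mul, X.inner_mul, hS]
    exact DFunLike.congr_fun this y
  intro x y
  have : innerL A (T' y) = (innerL A y).comp T := by
    refine hX.ext_of_mul hpq fun t e ξ η => ?_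
    simp only [ContinuousLinearMap.comp_apply, innerL_apply]
    rw [← star_inner, ← h1, star_inner]
  have h2 := DFunLike.congr_fun this x
  simp only [ContinuousLinearMap.comp_apply, innerL_apply] at h2
  rw [← star_inner, ← h2, star_inner]

/-- The operator `T` plays the role of `S ⊗ 1`, and the estimate avoids positivity in tensor
products. The powers of `G = T'T` act on products through the powers of `H = S'S`, so on the span of
products they grow at most like `‖H‖ ^ n`, with a constant depending on the vector. By
`norm_apply_le_of_growth` the constant disappears, and `‖T z‖² ≤ ‖z‖ ‖G z‖` with `‖H‖ ≤ ‖S‖²`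
finishes the bound on a dense set. -/
theorem norm_le_of_extends (hpq : p ≤ q) (h : Extends S T) (h' : Extends S' T')
    (hS : IsAdjointPair A S S') : ‖T‖ ≤ ‖S‖ := by
  have hT := hX.isAdjointPair hpq h h' hS
  have e : p + (q - p) = q := add_tsub_cancel_of_le hpq
  set G := T' * T with hG
  set H := S' * S with hH
  have hGH : ∀ n ξ η, (G ^ n) (X.mul e ξ η) = X.mul e ((H ^ n) ξ) η := by
    intro n ξ η
    induction n with
    | zero => rfl
    | succ n ih =>
      rw [pow_succ', pow_succ', mul_apply_eq_comp, ih]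
      exact (congrArg T' (h _ e _ _)).trans (h' _ e _ _)
  have hGs : IsAdjointPair A G G := fun x y =>
    (hT.symm (T x) y).trans (hT x (T y))
  have hpow : ∀ n, ‖H ^ n‖ ≤ ‖H‖ ^ n := by
    intro n
    induction n with
    | zero => rw [pow_zero, pow_zero]; exact ContinuousLinearMap.norm_id_le
    | succ n ih =>
      rw [pow_succ, pow_succ]
      exact (_root_.norm_mul_le _ _).trans (by gcongr)
  have hgrowth : ∀ z ∈ Submodule.span ℂ {z : X.X q | ∃ x y, X.mul e x y = z},
      ∃ C : ℝ, ∀ n, ‖(G ^ n) z‖ ≤ C * ‖H‖ ^ n := by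
    intro z hz
    induction hz using Submodule.span_induction with
    | mem z hz =>
      obtain ⟨ξ, η, rfl⟩ := hz
      refine ⟨‖ξ‖ * ‖η‖, fun n => ?_⟩
      rw [hGH]
      calc _ ≤ ‖H‖ ^ n * ‖ξ‖ * ‖η‖ := by
            refine (hX.norm_mul_le e _ _).trans ?_
            gcongr
            refine ((H ^ n).le_opNorm ξ).trans ?_
            gcongr
            exact hpow n
        _ = _ := by ring
    | zero => exact ⟨0, fun n => by simp⟩
    | add z w _ _ hz hw =>
      obtain ⟨C, h1⟩ := hz
      obtain ⟨D, h2⟩ := hw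
      refine ⟨C + D, fun n => ?_⟩
      rw [map_add, add_mul]
      exact (norm_add_le _ _).trans (add_le_add (h1 n) (h2 n))
    | smul c z _ hz =>
      obtain ⟨C, h1⟩ := hz
      refine ⟨‖c‖ * C, fun n => ?_⟩
      rw [map_smul, norm_smul, _root_.mul_assoc]
      gcongr
      exact h1 n
  have hHn : ‖H‖ ≤ ‖S‖ ^ 2 := by
    rw [sq]
    exact (_root_.norm_mul_le _ _).trans (by gcongr; exact hS.norm_le)
  have hbound : ∀ z ∈ Submodule.span ℂ {z : X.X q | ∃ x y, X.mul e x y = z},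
      ‖T z‖ ≤ ‖S‖ * ‖z‖ := by
    intro z hz
    obtain ⟨C, h1⟩ := hgrowth z hz
    have h2 := norm_apply_le_of_growth hGs z (norm_nonneg _) h1
    refine le_of_sq_le_sq ?_ (by positivity)
    rw [norm_sq (A := A), hT]
    calc _ ≤ ‖z‖ * ‖G z‖ := norm_inner_le _ _
      _ ≤ ‖z‖ * (‖S‖ ^ 2 * ‖z‖) := by gcongr; exact h2.trans (by gcongr)
      _ = _ := by ring
  refine T.opNorm_le_bound (norm_nonneg _) fun z => ?_
  have hd : Dense (Submodule.span ℂ {z : X.X q | ∃ x y, X.mul e x y = z} : Set (X.X q)) :=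
    Submodule.dense_iff_topologicalClosure_eq_top.2 (hX.dense_mul e)
  exact hd.induction (P := fun z => ‖T z‖ ≤ ‖S‖ * ‖z‖) hbound
    (isClosed_le (by fun_prop) (by fun_prop)) z

end IsRegular

end ProductSystem

/-! ### Extending compact operators to larger fibres, compatibly with covariant representations. -/

namespace ProductSystem

universe u v

variable {k : ℕ} {A : Type u} [NonUnitalCStarAlgebra A] {X : ProductSystem k A}

open ToeplitzRep

theorem Extends.of_add_eq {p q t : Fin k → ℕ} {S : X.X p →L[ℂ] X.X p} {T : X.X q →L[ℂ] X.X q}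
    (e : p + t = q) (h : ∀ ξ η, T (X.mul e ξ η) = X.mul e (S ξ) η) : Extends S T := by
  intro t' e' ξ η
  obtain rfl : t = t' := add_left_cancel (e.trans e'.symm)
  exact h ξ η

/-- `T` is a compact operator extending `S`, with the same image as `S` under every covariant
representation. -/
structure IsCovariantExtension {p q : Fin k → ℕ} (S : X.X p →L[ℂ] X.X p)
    (T : X.X q →L[ℂ] X.X q) : Prop where
  mem : T ∈ X.K q
  extends_mul : Extends S T
  compactMap_eq : ∀ (B : Type u) [NonUnitalCStarAlgebra B] (ψ : X.ToeplitzRep B), X.IsCPK B ψ →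
    ψ.compactMap q T = ψ.compactMap p S

namespace IsCovariantExtension

variable {p q : Fin k → ℕ} {S S' : X.X p →L[ℂ] X.X p} {T T' : X.X q →L[ℂ] X.X q}

theorem add (hS : S ∈ X.K p) (hS' : S' ∈ X.K p) (h : IsCovariantExtension S T)
    (h' : IsCovariantExtension S' T') : IsCovariantExtension (S + S') (T + T') where
  mem := add_mem h.mem h'.mem
  extends_mul := h.extends_mul.add h'.extends_mul
  compactMap_eq B _ ψ hψ := by
    rw [ψ.compactMap_add h.mem h'.mem, ψ.compactMap_add hS hS', h.compactMap_eq B ψ hψ,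
      h'.compactMap_eq B ψ hψ]

theorem smul (c : ℂ) (hS : S ∈ X.K p) (h : IsCovariantExtension S T) :
    IsCovariantExtension (c • S) (c • T) where
  mem := Submodule.smul_mem _ c h.mem
  extends_mul := h.extends_mul.smul c
  compactMap_eq B _ ψ hψ := by
    rw [ψ.compactMap_smul c h.mem, ψ.compactMap_smul c hS, h.compactMap_eq B ψ hψ]

theorem zero : IsCovariantExtension (0 : X.X p →L[ℂ] X.X p) (0 : X.X q →L[ℂ] X.X q) where
  mem := zero_mem _
  extends_mul := Extends.zero
  compactMap_eq B _ ψ hψ := by rw [compactMap_zero, compactMap_zero]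

end IsCovariantExtension

namespace IsRegular

variable (hX : X.IsRegular)
include hX

/-- This is the approximation property of a regular system read in the zero fibre, where the right
action is multiplication in `A`. -/
theorem dense_products : Dense {a : A | ∃ b c, b * c = a} := by
  refine Metric.dense_iff.2 fun a ε hε => ?_
  obtain ⟨ξ, c, -, h⟩ := hX.exists_finiteRank 0 (X.unit a) ε hε
  obtain ⟨b, rfl⟩ := X.unit.surjective ξ
  rw [X.right_unit, ← map_sub, norm_unit] at h
  exact ⟨b * c, by rwa [Metric.mem_ball, dist_comm, dist_eq_norm], b, c, rfl⟩

/-- A product `bc` acts on the zero fibre as the rank-one operator of `b` and `c^*`; such products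
are dense and `φ_0` is continuous. -/
theorem phi_zero_mem (a : A) : X.phi 0 a ∈ X.K 0 := by
  refine hX.dense_products.induction (P := fun a => X.phi 0 a ∈ X.K 0) ?_ ?_ a
  · rintro _ ⟨b, c, rfl⟩
    rw [← star_star c, ← theta_unit]
    exact theta_mem_compacts _ _
  · exact (Submodule.isClosed_topologicalClosure _).preimage X.phiZero.continuous

theorem compactMap_phi_zero {B : Type v} [NonUnitalCStarAlgebra B] (ψ : X.ToeplitzRep B) (a : A) :
    ψ.compactMap 0 (X.phi 0 a) = ψ.base a := by
  rw [ψ.compactMap_of_mem (hX.phi_zero_mem a)]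
  refine hX.dense_products.induction
    (P := fun a => ψ.compactMapL 0 ⟨X.phi 0 a, hX.phi_zero_mem a⟩ = ψ.base a) ?_ ?_ a
  · rintro _ ⟨b, c, rfl⟩
    rw [← ψ.compactMap_of_mem, ← star_star c, ← theta_unit, ψ.compactMap_theta, ψ.map_unit,
      ψ.map_unit, ← map_star, ← _root_.map_mul]
  · refine isClosed_eq ((ψ.compactMapL 0).continuous.comp
      (X.phiZero.continuous.subtype_mk hX.phi_zero_mem)) ?_
    exact AddMonoidHomClass.continuous_of_bound ψ.base 1 fun a => by
      rw [one_mul]; exact NonUnitalStarAlgHom.norm_apply_le ψ.base a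

/-- The factor `a` between `ξ` and `η` is what makes the extension compact: on `X_{q-p}` it acts as
a finite combination of rank-one operators, which can be absorbed into `ξ` and `η`. The same
combination, inserted between `ψ(ξ)` and `ψ(η)^*`, becomes `ψ_0(a)` by (CP-K). -/
theorem exists_extension_theta {p q : Fin k → ℕ} (hpq : p ≤ q) (ξ η : X.X p) {a : A}
    (ha : ∀ t, ∃ x, X.phi t a = thetaComb t x) :
    ∃ T : X.X q →L[ℂ] X.X q, IsCovariantExtension (theta A (right ξ a) η) T := by
  have e : p + (q - p) = q := add_tsub_cancel_of_le hpq
  -- For any finite combination `R` of rank-one operators on `X_{q-p}`, there is a compact operator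
  -- playing the role of `ξ R η^*`. Neither `a` nor covariance enters yet, so induction on the
  -- combination is possible.
  have key : ∀ x : X.X (q - p) × X.X (q - p) →₀ ℂ, ∃ T ∈ X.K q,
      (∀ ζ ω, T (X.mul e ζ ω) =
        X.mul e ξ (thetaComb (q - p) x (X.phi (q - p) (inner (A := A) η ζ) ω))) ∧
      ∀ (B : Type u) [NonUnitalCStarAlgebra B] (ψ : X.ToeplitzRep B),
        ψ.compactMap q T = ψ.toFun p ξ * ψ.repComb (q - p) x * star (ψ.toFun p η) := by
    intro x
    induction x using Finsupp.induction_linear with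
    | zero => exact ⟨0, zero_mem _, by simp, fun B _ ψ => by simp [compactMap_zero]⟩
    | add x y hx hy =>
      obtain ⟨T, hT, h1, h2⟩ := hx
      obtain ⟨T', hT', h1', h2'⟩ := hy
      refine ⟨T + T', add_mem hT hT', fun ζ ω => by simp [h1, h1'], fun B _ ψ => ?_⟩
      rw [ψ.compactMap_add hT hT', h2, h2', map_add, _root_.mul_add, add_mul]
    | single uv c =>
      obtain ⟨u, v⟩ := uv
      -- This works since `⟨ηv, ζω⟩ = ⟨v, ⟨η, ζ⟩ω⟩`, whence `Θ_{ξu,ηv}(ζω) = ξ Θ_{u,v}(⟨η, ζ⟩ω)`.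
      refine ⟨c • theta A (X.mul e ξ u) (X.mul e η v), Submodule.smul_mem _ c
        (theta_mem_compacts _ _), fun ζ ω => ?_, fun B _ ψ => ?_⟩
      · simp only [thetaComb, Finsupp.linearCombination_single, _root_.smul_apply, map_smul]
        rw [theta_apply, theta_apply, X.inner_mul, right_mul]
      · rw [ψ.compactMap_smul c (theta_mem_compacts _ _), compactMap_theta, ψ.map_mul, ψ.map_mul]
        simp only [repComb, Finsupp.linearCombination_single, star_mul, mul_smul_comm,
          smul_mul_assoc, _root_.mul_assoc]
  obtain ⟨x, hx⟩ := ha (q - p)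
  obtain ⟨T, hT, h1, h2⟩ := key x
  refine ⟨T, hT, .of_add_eq e fun ζ ω => ?_, fun B _ ψ hψ => ?_⟩
  -- Both coefficients, `a` and `⟨η, ζ⟩`, pass from the left of `ω` to the right of `ξ`.
  · rw [h1, ← hx, mul_left, mul_left, theta_apply]
  -- The orthogonality condition in (CP-K) is vacuous, since `φ_{q-p}` has zero kernel.
  · have h3 := hψ (q - p) a (hx ▸ thetaComb_mem x) fun b hb => by
      rw [hX.phi_injective (q - p) (hb.trans (map_zero _).symm), mul_zero]
    rw [hx, compactMap_thetaComb] at h3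
    rw [h2, h3, compactMap_theta, ψ.map_right]

/-- Every compact operator on a fibre extends to the larger fibres. -/
theorem exists_extension {p q : Fin k → ℕ} (hpq : p ≤ q) {S : X.X p →L[ℂ] X.X p}
    (hS : S ∈ X.K p) : ∃ T : X.X q →L[ℂ] X.X q, IsCovariantExtension S T := by
  -- Elements of `N` carry an adjoint that extends too, because the norm estimate for extensions
  -- needs an extension of the adjoint.
  let N : Submodule ℂ (X.X p →L[ℂ] X.X p) :=
    { carrier := {S | S ∈ X.K p ∧ (∃ T : X.X q →L[ℂ] X.X q, IsCovariantExtension S T) ∧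
        ∃ S' ∈ X.K p, IsAdjointPair A S S' ∧
          ∃ T' : X.X q →L[ℂ] X.X q, IsCovariantExtension S' T'}
      add_mem' := by
        rintro S₁ S₂ ⟨h₁, ⟨T₁, hT₁⟩, S₁', h₁', ha₁, T₁', hT₁'⟩
          ⟨h₂, ⟨T₂, hT₂⟩, S₂', h₂', ha₂, T₂', hT₂'⟩
        exact ⟨add_mem h₁ h₂, ⟨_, hT₁.add h₁ h₂ hT₂⟩, _, add_mem h₁' h₂', ha₁.add ha₂, _,
          hT₁'.add h₁' h₂' hT₂'⟩
      zero_mem' := ⟨zero_mem _, ⟨0, .zero⟩, 0, zero_mem _, fun x y => by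
        simp only [_root_.zero_apply, ← innerL_apply, map_zero]
        rw [innerL_apply, ← star_inner, ← innerL_apply, map_zero, star_zero], 0, .zero⟩
      smul_mem' := by
        rintro c S ⟨h, ⟨T, hT⟩, S', h', ha, T', hT'⟩
        exact ⟨Submodule.smul_mem _ c h, ⟨_, hT.smul c h⟩, _, Submodule.smul_mem _ _ h',
          ha.smul c, _, hT'.smul _ h'⟩ }
  have hN : X.K p ≤ N.topologicalClosure := by
    refine compacts_le (A := A) N.isClosed_topologicalClosure fun ξ η => ?_
    refine Metric.mem_closure_iff.2 fun ε hε => ?_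
    -- The error is at most `(ε / M)(‖ξ‖ + ‖η‖ + 1)`, where the `1` comes from `‖ξ'a‖ ≤ ‖ξ‖ + 1`;
    -- the second `1` makes the inequality strict. Both vectors are approximated so that the adjoint
    -- `Θ_{η'b,ξ'a}` is extendable as well.
    set M := ‖ξ‖ + ‖η‖ + 2 with hM
    have hM0 : 0 < M := by positivity
    obtain ⟨ξ', a, ha, h1⟩ := hX.exists_finiteRank p ξ (min 1 (ε / M)) (by positivity)
    obtain ⟨η', b, hb, h2⟩ := hX.exists_finiteRank p η (ε / M) (by positivity)
    refine ⟨theta A (right ξ' a) (right η' b), ⟨theta_mem_compacts _ _,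
      hX.exists_extension_theta hpq _ _ ha, _, theta_mem_compacts _ _, isAdjointPair_theta _ _,
      hX.exists_extension_theta hpq _ _ hb⟩, ?_⟩
    rw [dist_eq_norm]
    have h3 : ‖right ξ' a‖ ≤ ‖ξ‖ + 1 := by
      have h4 := norm_sub_le ξ (ξ - right ξ' a)
      rw [sub_sub_cancel] at h4
      linarith [h1.trans_le (min_le_left _ _)]
    calc _ ≤ ‖ξ - right ξ' a‖ * ‖η‖ + ‖right ξ' a‖ * ‖η - right η' b‖ := norm_theta_sub_le _ _ _ _
      _ ≤ (ε / M) * ‖η‖ + (‖ξ‖ + 1) * (ε / M) := by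
        gcongr
        exact (h1.trans_le (min_le_right _ _)).le
      _ < (ε / M) * M := by rw [hM]; nlinarith [div_pos hε hM0]
      _ = ε := div_mul_cancel₀ _ hM0.ne'
  obtain ⟨s, hs, hlim⟩ := mem_closure_iff_seq_limit.1 (hN hS)
  choose hsK hsT s' hs'K hs'a hs'T using hs
  choose T hT using hsT
  choose T' hT' using hs'T
  -- Extension is contractive on differences, so the extensions of a convergent sequence form a
  -- Cauchy sequence. The three defining properties of the extension pass to its limit.
  have hdist : ∀ m n, dist (T m) (T n) ≤ dist (s m) (s n) := by
    intro m n
    rw [dist_eq_norm, dist_eq_norm]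
    have e : ∀ {i} (U V : X.X i →L[ℂ] X.X i), U - V = U + (-1 : ℂ) • V := fun U V => by
      rw [neg_one_smul, sub_eq_add_neg]
    rw [e, e]
    exact hX.norm_le_of_extends hpq ((hT m).extends_mul.add ((hT n).extends_mul.smul _))
      ((hT' m).extends_mul.add ((hT' n).extends_mul.smul _)) ((hs'a m).add ((hs'a n).smul _))
  have hcau : CauchySeq T := by
    rw [Metric.cauchySeq_iff]
    intro ε hε
    obtain ⟨n₀, h⟩ := Metric.cauchySeq_iff.1 hlim.cauchySeq ε hε
    exact ⟨n₀, fun m hm n hn => (hdist m n).trans_lt (h m hm n hn)⟩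
  obtain ⟨T₀, hT₀⟩ := cauchySeq_tendsto_of_complete hcau
  have hmem : T₀ ∈ X.K q :=
    (Submodule.isClosed_topologicalClosure _).mem_of_tendsto hT₀ (.of_forall fun n => (hT n).mem)
  refine ⟨T₀, hmem, fun t e ξ η => ?_, fun B _ ψ hψ => ?_⟩
  · have h1 := ((ContinuousLinearMap.apply ℂ (X.X q) (X.mul e ξ η)).continuous.tendsto T₀).comp hT₀
    have hc : Continuous fun z => X.mul e z η :=
      AddMonoidHomClass.continuous_of_bound ((X.mul e).flip η) ‖η‖ fun z =>
        (hX.norm_mul_le e z η).trans_eq (mul_comm _ _)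
    have h2 := (hc.tendsto (S ξ)).comp
      (((ContinuousLinearMap.apply ℂ (X.X p) ξ).continuous.tendsto S).comp hlim)
    exact tendsto_nhds_unique (h1.congr fun n => (hT n).extends_mul t e ξ η) h2
  · have h1 := ((ψ.compactMapL q).continuous.tendsto ⟨T₀, hmem⟩).comp
      (tendsto_subtype_rng.2 hT₀ : Filter.Tendsto (fun n => (⟨T n, (hT n).mem⟩ : X.K q)) _ _)
    have h2 := ((ψ.compactMapL p).continuous.tendsto ⟨S, hS⟩).comp
      (tendsto_subtype_rng.2 hlim : Filter.Tendsto (fun n => (⟨s n, hsK n⟩ : X.K p)) _ _)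
    rw [ψ.compactMap_of_mem hmem, ψ.compactMap_of_mem hS]
    refine tendsto_nhds_unique (h1.congr fun n => ?_) h2
    have := (hT n).compactMap_eq B ψ hψ
    rwa [ψ.compactMap_of_mem (hT n).mem, ψ.compactMap_of_mem (hsK n)] at this

/-! ### The operators `ι_p^q`, compact alignment and the modules `X̃_q`. -/

/-- Since `ι_p^q(S)` is obtained by choice, it has to be identified through uniqueness of
extensions. For `p = 0` the definition speaks of `φ_q(a)` instead, which extends `φ_0(a)`. -/
theorem iota_eq {p q : Fin k → ℕ} (hpq : p ≤ q) {S : X.X p →L[ℂ] X.X p} {T : X.X q →L[ℂ] X.X q}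
    (hS : p = 0 → ∃ a, S = X.phi p a) (h : Extends S T) : X.iota p q S = T := by
  have hex : ∃ T, X.IsInduced p q S T := by
    refine ⟨T, hpq, fun hp => ?_, fun _ => h⟩
    obtain ⟨a, rfl⟩ := hS hp
    exact ⟨a, rfl, hX.unique hpq h (extends_phi a)⟩
  rw [iota, dif_pos hex]
  refine hX.unique hpq ?_ h
  by_cases hp : p = 0
  · obtain ⟨a, h1, h2⟩ := hex.choose_spec.2.1 hp
    rw [h2, h1]
    exact extends_phi a
  · exact hex.choose_spec.2.2 hp

theorem iota_phi {p q : Fin k → ℕ} (hpq : p ≤ q) (a : A) :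
    X.iota p q (X.phi p a) = X.phi q a :=
  hX.iota_eq hpq (fun _ => ⟨a, rfl⟩) (extends_phi a)

theorem isCovariantExtension_iota {p q : Fin k → ℕ} (hpq : p ≤ q) {S : X.X p →L[ℂ] X.X p}
    (hS : S ∈ X.K p) : IsCovariantExtension S (X.iota p q S) := by
  obtain ⟨T, hT⟩ := hX.exists_extension hpq hS
  rwa [hX.iota_eq hpq (fun hp => by subst hp; exact exists_phi_zero hS) hT.extends_mul]

theorem compactlyAligned : X.CompactlyAligned := fun _ _ _ hS _ hT =>
  mul_mem_compacts (hX.isCovariantExtension_iota le_sup_left hS).mem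
    (hX.isCovariantExtension_iota le_sup_right hT).mem

theorem fibreIdeal_univ (q : Fin k → ℕ) : X.fibreIdeal q Set.univ = ⊤ := by
  rw [eq_top_iff]
  rintro ξ -
  refine Metric.mem_closure_iff.2 fun ε hε => ?_
  obtain ⟨ξ', a, -, h⟩ := hX.exists_finiteRank q ξ ε hε
  exact ⟨_, Submodule.subset_span ⟨ξ', a, trivial, rfl⟩, (dist_eq_norm _ _).trans_lt h⟩

/-- For `p ≠ q` the ideal `I_{q-p}` lies in the kernel of the injective map `φ_{q-p}`, so it is
zero. Only the top coordinate of `X̃_q` survives. -/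
theorem tilde_apply_eq_zero {q : Fin k → ℕ} (ξ : X.tilde q) (p : Set.Iic q) (hp : p.1 ≠ q) :
    ξ.1 p = 0 := by
  have h := ξ.2 p trivial
  have hp0 : q - p.1 ≠ 0 := fun h0 =>
    hp (le_antisymm p.2 (tsub_eq_zero_iff_le.1 h0))
  have hle : X.fibreIdeal p.1 (X.kerIdeal (q - p.1)) ≤ ⊥ := by
    refine Submodule.topologicalClosure_minimal _ (Submodule.span_le.2 ?_) ?_
    · rintro _ ⟨η, a, ha, rfl⟩
      have ha0 : a = 0 := hX.phi_injective (q - p.1) ((ha _ hp0 le_rfl).trans (map_zero _).symm)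
      have h0 := right_smul η (0 : ℂ) (0 : A)
      rw [zero_smul, zero_smul] at h0
      rw [ha0]
      exact h0
    · exact isClosed_singleton
  exact hle h

/-- The vector of `X̃_q` with the entry `ξ` over `q`. -/
theorem exists_tilde (q : Fin k → ℕ) (ξ : X.X q) : ∃ η : X.tilde q, η.1 ⟨q, Set.self_mem_Iic⟩ = ξ := by
  classical
  refine ⟨⟨Pi.single ⟨q, Set.self_mem_Iic⟩ ξ, fun p _ => ?_⟩, Pi.single_eq_same _ _⟩
  by_cases hp : p = ⟨q, Set.self_mem_Iic⟩
  · subst hp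
    -- No `r` satisfies `0 < r ≤ 0`, so `I_0 = A`, and `X_q · A` is dense in `X_q`.
    have : X.kerIdeal (q - q) = Set.univ := Set.eq_univ_of_forall fun a r hr hr' =>
      absurd (le_antisymm (hr'.trans_eq (tsub_self q)) (zero_le)) hr
    change _ ∈ X.fibreIdeal q (X.kerIdeal (q - q))
    rw [this, hX.fibreIdeal_univ]
    trivial
  · rw [Pi.single_eq_of_ne hp]
    exact zero_mem _

theorem tildePhi_injective (q : Fin k → ℕ) : Function.Injective (X.tildePhi q) := by
  intro a b hab
  refine hX.phi_injective q (ContinuousLinearMap.ext fun ξ => ?_)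
  obtain ⟨η, rfl⟩ := hX.exists_tilde q ξ
  exact congrFun (congrFun hab η) ⟨q, Set.self_mem_Iic⟩

/-! ### Equivalence of the covariance conditions and identification of the universal algebras. -/

/-- The operators `-φ_0(a)` and `φ_m(a)` both induce multiples of `φ_s(a)` on `X_s` for `s ≥ m`, and
these cancel. So (CP-SY) gives `ψ^{(m)}(φ_m(a)) = ψ^{(0)}(φ_0(a)) = ψ_0(a)`. -/
theorem isCPK_of_isCNP {B : Type v} [NonUnitalCStarAlgebra B] {ψ : X.ToeplitzRep B}
    (h : X.IsCNP B ψ) : X.IsCPK B ψ := by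
  intro m a ha _
  -- For `m = 0` the index set `{0, m}` would collapse to one point, and the claim holds for every
  -- representation.
  by_cases hm : m = 0
  · subst hm
    exact hX.compactMap_phi_zero ψ a
  let c : (Fin k → ℕ) → A := fun p => if p = 0 then -a else a
  have hc0 : c 0 = -a := if_pos rfl
  have hcm : c m = a := if_neg hm
  have hsum := h.1 {0, m} (fun p => X.phi p (c p)) (by
    intro p hp
    rcases Finset.mem_insert.1 hp with rfl | hp
    · exact hX.phi_zero_mem _
    · rw [Finset.mem_singleton.1 hp, hcm]
      exact ha) ?_
  · rw [Finset.sum_pair (Ne.symm hm), hc0, hcm, hX.compactMap_phi_zero, map_neg] at hsum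
    exact (neg_add_eq_zero.1 hsum).symm
  -- Above `q ⊔ m` both operators induce on the top coordinate `r = s`; in the lower coordinates the
  -- vector is zero.
  · refine fun q => ⟨q ⊔ m, le_sup_left, fun s hs => funext fun ξ => funext fun r => ?_⟩
    rw [Finset.sum_pair (Ne.symm hm), hc0, hcm]
    change X.iota 0 r.1 (X.phi 0 (-a)) (ξ.1 r) + X.iota m r.1 (X.phi m a) (ξ.1 r) = 0
    by_cases hr : r.1 = s
    · rw [hX.iota_phi (zero_le), hX.iota_phi ((le_sup_right.trans hs).trans hr.ge), map_neg]
      exact neg_add_cancel _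
    · rw [hX.tilde_apply_eq_zero ξ r hr, map_zero, map_zero, add_zero]

/-- Under (CP-K), `ψ^{(p)}(S) = ψ^{(q)}(ι_p^q(S))` for `p ≤ q`. Hence (CP-SY) follows from linearity
of `ψ^{(s)}` on one fibre above all of `F`, and (N) from multiplicativity of `ψ^{(p∨q)}`. -/
theorem isCNP_of_isCPK {B : Type u} [NonUnitalCStarAlgebra B] {ψ : X.ToeplitzRep B}
    (h : X.IsCPK B ψ) : X.IsCNP B ψ := by
  refine ⟨fun F T hT hF => ?_, fun p q S hS T hT => ?_⟩
  -- A single fibre is enough: `s` dominates every degree in `F`, and the sum vanishes there.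
  · obtain ⟨s, hs, hz⟩ := hF (F.sup id)
    have hle : ∀ p ∈ F, p ≤ s := fun p hp => (Finset.le_sup (f := id) hp).trans hs
    have hι := fun p hp => hX.isCovariantExtension_iota (hle p hp) (hT p hp)
    -- Every vector of `X_s` is the top coordinate of some vector of `X̃_s`, so the vanishing on
    -- `X̃_s` can be read off there.
    have h0 : ∑ p ∈ F, X.iota p s (T p) = 0 := by
      refine ContinuousLinearMap.ext fun ξ => ?_
      obtain ⟨η, rfl⟩ := hX.exists_tilde s ξ
      have := congrFun (congrFun (hz s le_rfl) η) ⟨s, Set.self_mem_Iic⟩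
      simp only [Finset.sum_apply] at this
      rw [_root_.sum_apply]
      exact this
    rw [← Finset.sum_congr rfl fun p hp => (hι p hp).compactMap_eq B ψ h,
      ← ψ.compactMap_sum F fun p hp => (hι p hp).mem, h0, compactMap_zero]
  · have h1 := hX.isCovariantExtension_iota (le_sup_left : p ≤ p ⊔ q) hS
    have h2 := hX.isCovariantExtension_iota (le_sup_right : q ≤ p ⊔ q) hT
    rw [ψ.compactMap_mul h1.mem h2.mem, h1.compactMap_eq B ψ h, h2.compactMap_eq B ψ h]

theorem isCNP_eq_isCPK :
    (X.IsCNP : ∀ (B : Type u) [NonUnitalCStarAlgebra B], X.ToeplitzRep B → Prop) = X.IsCPK :=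
  funext fun _ => funext fun _ => funext fun _ =>
    propext ⟨hX.isCPK_of_isCNP, hX.isCNP_of_isCPK⟩

end IsRegular

/-- The universal algebra depends only on the predicate. Equal predicates give the same algebra with
the same generators, and the isomorphism is the identity. -/
theorem exists_univAlg_equiv
    {P Q : ∀ (B : Type u) [NonUnitalCStarAlgebra B], X.ToeplitzRep B → Prop} (h : P = Q) :
    ∃ Φ : X.UnivAlg P ≃⋆ₐ[ℂ] X.UnivAlg Q,
      ∀ m ξ, Φ ((X.univRep P).toFun m ξ) = (X.univRep Q).toFun m ξ := by
  subst h
  exact ⟨StarAlgEquiv.refl ℂ _, fun _ _ => rfl⟩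

end ProductSystem

/-! ### Regularity of the product system of a dynamical system. -/

namespace TDS

universe u

variable {k : ℕ} {Ω : Type u} [TopologicalSpace Ω] [T2Space Ω] [LocallyCompactSpace Ω]
  (D : TDS k Ω)

open TopologicalGraph ProductSystem ToeplitzRep

/-- The compactly supported function `f` as an element of the fibre over `m`. -/
theorem exists_corr (m : Fin k → ℕ) {f : Ω → ℂ} (hf : Continuous f) (hs : HasCompactSupport f) :
    ∃ ξ : (D.kGraph.graph m).Corr, ∀ x, ξ.ev (D.pt m x) = f x := by
  have hc : Continuous fun l : D.kGraph.Path m => f l.1.2 := hf.comp (D.pathHomeo m).continuous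
  have hs' : HasCompactSupport fun l : D.kGraph.Path m => f l.1.2 :=
    hs.comp_homeomorph (D.pathHomeo m)
  obtain ⟨B, hB, hB'⟩ := exists_fibreBound (G := D.kGraph.graph m) hc hs'
  exact ⟨⟨Sections.mk _ B hB hB', Submodule.le_topologicalClosure _ ⟨hc, hs'⟩⟩, fun x => rfl⟩

theorem exists_bump {K U : Set Ω} (hK : IsCompact K) (hU : IsOpen U) (hKU : K ⊆ U) :
    ∃ f : C₀(Ω, ℂ), HasCompactSupport f ∧ (∀ x ∈ K, f x = 1) ∧ ∀ x ∉ U, f x = 0 := by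
  obtain ⟨g, h1, h0, hs, -⟩ := exists_continuous_one_zero_of_isCompact hK hU.isClosed_compl
    (Set.disjoint_compl_right_iff_subset.2 hKU)
  have hs' : HasCompactSupport fun x => (g x : ℂ) :=
    hs.comp_left (g := Complex.ofReal) Complex.ofReal_zero
  refine ⟨⟨⟨_, Complex.continuous_ofReal.comp g.continuous⟩, hs'.is_zero_at_infty⟩, hs',
    fun x hx => ?_, fun x hx => ?_⟩
  · change (g x : ℂ) = 1
    rw [h1 hx]; simp
  · change (g x : ℂ) = 0
    rw [h0 hx]; simp

theorem ev_phi (m : Fin k → ℕ) (f : C₀(Ω, ℂ)) (ξ : D.productSystem.X m) (x : Ω) :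
    Corr.ev (G := D.kGraph.graph m) (D.productSystem.phi m f ξ) (D.pt m x) =
      f x * Corr.ev (G := D.kGraph.graph m) ξ (D.pt m x) := rfl

theorem ev_right (m : Fin k → ℕ) (f : C₀(Ω, ℂ)) (ξ : D.productSystem.X m) (x : Ω) :
    Corr.ev (G := D.kGraph.graph m) (right ξ f : D.productSystem.X m) (D.pt m x) =
      f (D.Theta m x) * Corr.ev (G := D.kGraph.graph m) ξ (D.pt m x) := rfl

theorem ev_theta (m : Fin k → ℕ) (ξ η ζ : D.productSystem.X m) (x : Ω) :
    Corr.ev (G := D.kGraph.graph m) (theta C₀(Ω, ℂ) ξ η ζ : D.productSystem.X m) (D.pt m x) =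
      (∑' e : {e // (D.kGraph.graph m).s e = D.Theta m x},
        star (Corr.ev (G := D.kGraph.graph m) η e) * Corr.ev (G := D.kGraph.graph m) ζ e) *
      Corr.ev (G := D.kGraph.graph m) ξ (D.pt m x) := by
  rw [theta_apply, ev_right]
  congr 1
  exact Corr.innerC_apply (G := D.kGraph.graph m) η ζ _

/-- A function with support in a set on which `Θ_m` is injective acts by a rank-one operator. -/
theorem exists_phi_eq_theta (m : Fin k → ℕ) {U : Set Ω} (hU : IsOpen U)
    (hinj : Set.InjOn (D.Theta m) U) {f : C₀(Ω, ℂ)} (hf : HasCompactSupport f)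
    (hfU : tsupport f ⊆ U) : ∃ ξ η : D.productSystem.X m,
      D.productSystem.phi m f = theta C₀(Ω, ℂ) ξ η := by
  -- The operator is `Θ_{f,g}` with `g = 1` on the support of `f` and `g = 0` off `U`. If `f x ≠ 0`,
  -- then `x` is the only point of its `Θ_m`-fibre in `U`, so the inner product of `g` and `ζ` at
  -- `Θ_m(x)` reduces to `ζ(x)`.
  obtain ⟨g, hg, hg1, hg0⟩ := exists_bump hf hU hfU
  obtain ⟨ξ, hξ⟩ := D.exists_corr m (f := f) f.continuous hf
  obtain ⟨η, hη⟩ := D.exists_corr m (f := g) g.continuous hg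
  refine ⟨ξ, η, ContinuousLinearMap.ext fun ζ => Corr.ext_ev (D.forall_path fun x => ?_)⟩
  refine (D.ev_phi m f ζ x).trans (Eq.trans ?_ (D.ev_theta m ξ η ζ x).symm)
  rw [hξ]
  by_cases hx : f x = 0
  · rw [hx, zero_mul]
    exact (mul_zero _).symm
  have hxs : x ∈ tsupport f := subset_tsupport _ hx
  rw [tsum_eq_single ⟨D.pt m x, rfl⟩]
  · rw [hη, hg1 x hxs]
    simp [mul_comm]
  · rintro ⟨e, he⟩ hne
    obtain ⟨y, rfl⟩ := D.exists_pt e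
    have hy : y ∉ U := fun hy => hne (Subtype.ext (congrArg (D.pt m) (hinj hy (hfU hxs) he)))
    rw [hη, hg0 y hy, star_zero, zero_mul]

/-- Finitely many open sets on which `Θ_m` is injective cover the support of `f`. A partition of
unity subordinate to them writes `f` as a sum of functions that act by rank-one operators. -/
theorem exists_phi_eq_thetaComb (m : Fin k → ℕ) {f : C₀(Ω, ℂ)} (hf : HasCompactSupport f) :
    ∃ x, D.productSystem.phi m f = thetaComb m x := by
  have hloc : ∀ x : Ω, ∃ U : Set Ω, IsOpen U ∧ x ∈ U ∧ Set.InjOn (D.Theta m) U := fun x => by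
    obtain ⟨φ, hx, hφ⟩ := D.isLocalHomeomorph_Theta m x
    exact ⟨φ.source, φ.open_source, hx, hφ ▸ φ.injOn⟩
  choose U hU hxU hinj using hloc
  obtain ⟨t, -, ht⟩ := hf.isCompact.elim_nhds_subcover U fun x _ => (hU x).mem_nhds (hxU x)
  let c : Fin t.card → Set Ω := fun i => U (t.equivFin.symm i)
  have hcov : tsupport f ⊆ ⋃ i, c i := fun x hx => by
    obtain ⟨y, hy, hxy⟩ := Set.mem_iUnion₂.1 (ht hx)
    refine Set.mem_iUnion.2 ⟨t.equivFin ⟨y, hy⟩, ?_⟩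
    simpa [c] using hxy
  obtain ⟨g, hg1, hg2, -, -⟩ :=
    exists_continuous_sum_one_of_isOpen_isCompact (fun i => hU (t.equivFin.symm i)) hf.isCompact hcov
  have hs : ∀ i, HasCompactSupport fun x => f x * (g i x : ℂ) := fun i => hf.mul_right
  let F : Fin t.card → C₀(Ω, ℂ) := fun i =>
    ⟨⟨fun x => f x * (g i x : ℂ), f.continuous.mul (Complex.continuous_ofReal.comp (g i).continuous)⟩,
      (hs i).is_zero_at_infty⟩
  have hF : f = ∑ i, F i := by
    ext x
    have e : (∑ i, F i) x = ∑ i, f x * (g i x : ℂ) := by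
      let ev : C₀(Ω, ℂ) →+ ℂ :=
        { toFun := fun f => f x, map_zero' := rfl, map_add' := fun _ _ => rfl }
      exact map_sum ev F _
    rw [e, ← Finset.mul_sum]
    by_cases hx : x ∈ tsupport f
    · have := hg2 hx
      simp only [Finset.sum_apply, Pi.one_apply] at this
      rw [← Complex.ofReal_sum, this, Complex.ofReal_one, mul_one]
    · rw [image_eq_zero_of_notMem_tsupport hx, zero_mul]
  -- The support of `f g_i` lies in that of `g_i`, which the partition of unity places inside the
  -- `i`-th set.
  have hsub : ∀ i, tsupport (F i) ⊆ U (t.equivFin.symm i) := fun i => by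
    refine (closure_mono fun x hx => ?_).trans (hg1 i)
    intro h0
    refine hx ?_
    change f x * (g i x : ℂ) = 0
    rw [h0, Complex.ofReal_zero, mul_zero]
  choose ξ η h using fun i =>
    D.exists_phi_eq_theta m (hU _) (hinj _) (f := F i) (hs i) (hsub i)
  refine ⟨∑ i, Finsupp.single (ξ i, η i) 1, ?_⟩
  rw [hF, map_sum, map_sum]
  refine Finset.sum_congr rfl fun i _ => ?_
  rw [h i, thetaComb, Finsupp.linearCombination_single, one_smul]

/-- Injectivity of `φ_m` is tested pointwise, with a vector equal to `1` at the given point. For the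
approximation property, a compactly supported `w` near `ξ` satisfies `w · b = w` as soon as `b = 1`
on the image under `Θ_m` of the support of `w`; a compactly supported such `b` has finite rank on
all fibres. -/
theorem isRegular_productSystem : D.productSystem.IsRegular where
  dense_mul h := D.dense_mulCorr h
  norm_mul_le h ξ η := norm_mulSec_le h ξ.1 η.1
  phi_injective m := by
    intro f g hfg
    ext x
    obtain ⟨b, hb, hb1, -⟩ := exists_bump (isCompact_singleton (x := x)) isOpen_univ
      (Set.subset_univ _)
    obtain ⟨ξ, hξ⟩ := D.exists_corr m (f := b) b.continuous hb
    have h : f x * ξ.ev (D.pt m x) = g x * ξ.ev (D.pt m x) :=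
      congrArg (fun T : D.productSystem.X m →L[ℂ] D.productSystem.X m =>
        Corr.ev (G := D.kGraph.graph m) (T ξ) (D.pt m x)) hfg
    rwa [hξ, hb1 x rfl, mul_one, mul_one] at h
  exists_finiteRank m ξ ε hε := by
    obtain ⟨w, hw, hd⟩ := Metric.mem_closure_iff.1 ξ.2 ε hε
    -- The image under `Θ_m` is needed because the right action multiplies by `b ∘ Θ_m`.
    have hK : IsCompact (D.Theta m '' ((D.pathHomeo m) '' tsupport w.ev)) :=
      (hw.2.isCompact.image (D.pathHomeo m).continuous).image
        (D.isLocalHomeomorph_Theta m).continuous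
    obtain ⟨b, hb, hb1, -⟩ := exists_bump hK isOpen_univ (Set.subset_univ _)
    let ω : D.productSystem.X m := ⟨w, Submodule.le_topologicalClosure _ hw⟩
    refine ⟨ω, b, fun t => D.exists_phi_eq_thetaComb t hb, ?_⟩
    have e : right ω b = ω := Corr.ext_ev (D.forall_path fun x => by
      refine (D.ev_right m b ω x).trans ?_
      by_cases hx : w.ev (D.pt m x) = 0
      · exact (congrArg (b (D.Theta m x) * ·) hx).trans ((mul_zero _).trans hx.symm)
      · rw [hb1 _ ⟨x, ⟨D.pt m x, subset_tsupport _ hx, rfl⟩, rfl⟩, one_mul])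
    rw [e]
    rw [dist_eq_norm] at hd
    exact hd

end TDS

end

theorem corollary4p12 {k : ℕ} {Ω : Type*} [TopologicalSpace Ω] [T2Space Ω]
    [LocallyCompactSpace Ω] (D : TDS k Ω) :
    D.productSystem.CompactlyAligned ∧
    (∀ q, Function.Injective (D.productSystem.tildePhi q)) ∧
    ∃ Φ : D.productSystem.CuntzNicaPimsner ≃⋆ₐ[ℂ] D.productSystem.CuntzPimsner,
      ∀ m ξ, Φ (D.productSystem.jCNP.toFun m ξ) = D.productSystem.jFow.toFun m ξ := by
  have hX := D.isRegular_productSystem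
  exact ⟨hX.compactlyAligned, hX.tildePhi_injective,
    ProductSystem.exists_univAlg_equiv hX.isCNP_eq_isCPK⟩
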